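/- **Setting.** Constants are numbers or uninterpreted symbols; a ground atom is $p(c_1,\dots,c_k)$ with constants $c_i$. Fix a finite set $B$ of ground atoms (the Herbrand base, e.g. all atoms over a finite language); interpretations are the subsets of $B$. A (ground) standard aggregate atom is $\ell=\mathrm{agg}(s)\ \mathbf{op}\ v$, where $\mathrm{agg}\in\{\mathrm{Sum},\mathrm{Count},\mathrm{Min},\mathrm{Max},\mathrm{Avg}\}$, $\mathbf{op}\in\{=,\neq,<,>,\le,\ge\}$, $v$ is a number, and $s$ is an intensional set $\{X\mid p(t_1,\dots,t_k)\}$ or an intensional multiset $\{\!\{X\mid\exists Z_1,\dots,Z_r.\,p(t_1,\dots,t_k)\}\!\}$ whose arguments $t_i$ are constants or the variables $X$ (resp. $X,Z_1,\dots,Z_r$), all of these variables occurring. In an interpretation $M$, $s$ denotes the set of values of $X$ (resp. the multiset of values of $X$, one occurrence for each substitution of $X,Z_1,\dots,Z_r$) for which $p(t_1,\dots,t_k)$ is in $M$. $M\models\ell$ means that the aggregate of this set or multiset is defined and stands in relation $\mathbf{op}$ to $v$; here $\mathrm{Sum}$, $\mathrm{Min}$, $\mathrm{Max}$, $\mathrm{Avg}$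 are undefined if a non-numeric constant is collected, and for the empty collection $\mathrm{Sum}=\mathrm{Count}=0$, $\mathrm{Min}=+\infty$, $\mathrm{Max}=-\infty$, and $\mathrm{Avg}$ is undefined. Let $\mathcal H(\ell)$ be the set of atoms of $B$ with predicate $p$ and arity $k$; its size is its number of symbol occurrences $(k+1)|\mathcal H(\ell)|$. A pair $\langle I,J\rangle$ of disjoint subsets of $\mathcal H(\ell)$ is an aggregate solution of $\ell$ if $M\models\ell$ for every interpretation $M$ with $I\subseteq M$ and $J\cap M=\emptyset$. Call $\ell$ *admissible* if it is not of the form $\mathrm{Sum}(s)\neq v$ or $\mathrm{Avg}(s)\neq v$. A ground program $P$ over $B$ is a finite list of rules $A\leftarrow C_1,\dots,C_m,A_1,\dots,A_n,\mathrm{not}\,B_1,\dots,\mathrm{not}\,B_q$ with atoms $A,A_i,B_i\in B$ and aggregate atoms $C_i$. For $M\subseteq B$ let $K^P_M(I)$ be the set of heads of the rules of $P$ with no $B_i\in M$, all $A_i\in I$, and $\langle I\cap M\cap\mathcal H(C_i),\ \mathcal H(C_i)\setminus M\rangle$ an aggregate solution of $C_i$ for all $i$. $M$ is an answer set of $P$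 if $M$ is the least fixpoint of $K^P_M$. **Statement.** 1. Let the numbers be real. There are an algorithm with unit-cost real arithmetic and a polynomial $f$ such that, given an admissible aggregate atom $\ell$, the set $\mathcal H(\ell)$ and disjoint $I,J\subseteq\mathcal H(\ell)$, the algorithm decides whether $\langle I,J\rangle$ is an aggregate solution of $\ell$ in at most $f(\mathrm{size}(\mathcal H(\ell)))$ steps. 2. Let the numbers be rational, written in binary. The same problem (given admissible $\ell$, the set $\mathcal H(\ell)$ and disjoint $I,J\subseteq\mathcal H(\ell)$, decide whether $\langle I,J\rangle$ is an aggregate solution of $\ell$) is in $\mathbf P$. 3. With numbers as in 2, for ground programs all of whose aggregate atoms are admissible (given with their finite Herbrand base $B$): deciding, given $P$ and $M\subseteq B$, whether $M$ is an answer set of $P$ is in $\mathbf P$; and deciding, given $P$, whether $P$ has an answer set is in $\mathbf{NP}$. -/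

import Mathlib

namespace AggSol

/-! ### Ground syntax

`K` is the ordered field of numeric constants (`ℚ` or `ℝ`; both contain the integers). Constants are
numbers or uninterpreted symbols. Predicates are identified by a name and an arity. -/

inductive Const (K : Type) where
  | num (x : K)
  | sym (n : ℕ)
  deriving DecidableEq

/-- A ground atom `p(c₁, …, cₙ)`. -/
structure Atom (K : Type) where
  pred : ℕ
  args : List (Const K)
  deriving DecidableEq

/-- An argument of the grouped predicate of a ground aggregate: a constant, or a grouped or local
variable. -/
inductive Term (K : Type) where
  | const (c : Const K)
  | var (i : ℕ)
  deriving DecidableEq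

/-- Intensional sets `{X | p(…)}` or intensional multisets `{{X | ∃ Z₁ … Zᵣ. p(…)}}`. -/
inductive Kind where
  | set
  | multiset
  deriving DecidableEq

/-- A ground intensional set or multiset. The grouped variable occurs among the arguments of the
grouped predicate; the other variables occurring there are the local variables `Z₁, …, Zᵣ`, and an
intensional set has none. -/
structure Intensional (K : Type) where
  kind : Kind
  grouped : ℕ
  pred : ℕ
  args : List (Term K)
  grouped_mem : Term.var grouped ∈ args
  set_no_local : kind = Kind.set → ∀ i, Term.var i ∈ args → i = grouped

inductive AggFn where
  | sum
  | count
  | min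
  | max
  | avg
  deriving DecidableEq

inductive RelOp where
  | eq
  | ne
  | lt
  | gt
  | le
  | ge
  deriving DecidableEq

/-- A ground aggregate atom `fn(s) op v`. -/
structure AggAtom (K : Type) where
  fn : AggFn
  s : Intensional K
  op : RelOp
  v : K

/-- All standard aggregate atoms except `Sum(s) ≠ v` and `Avg(s) ≠ v`. -/
def AggAtom.Tractable {K : Type} (l : AggAtom K) : Prop :=
  (l.fn ≠ AggFn.sum ∧ l.fn ≠ AggFn.avg) ∨ l.op ≠ RelOp.ne

/-- A ground rule `head ← aggs, pos, not neg`. -/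
structure Rule (K : Type) where
  head : Atom K
  aggs : List (AggAtom K)
  pos : List (Atom K)
  neg : List (Atom K)

/-! ### Semantics of aggregate atoms

Interpretations are subsets of a finite Herbrand base, hence finite sets of ground atoms. -/

section Semantics

variable {K : Type}

def Term.inst (γ : ℕ → Const K) : Term K → Const K
  | .const c => c
  | .var i => γ i

/-- The instance of the grouped atom under a ground substitution of its variables. -/
def Intensional.inst (s : Intensional K) (γ : ℕ → Const K) : Atom K :=
  ⟨s.pred, s.args.map (Term.inst γ)⟩

/-- The value that an instance of the grouped atom gives to the grouped variable: the argument at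
a position where that variable occurs. -/
def Intensional.proj [DecidableEq K] (s : Intensional K) (a : Atom K) : Const K :=
  a.args.getD (s.args.idxOf (Term.var s.grouped)) (Const.sym 0)

theorem Intensional.proj_inst [DecidableEq K] (s : Intensional K) (γ : ℕ → Const K) :
    s.proj (s.inst γ) = γ s.grouped := by
  have h : s.args.idxOf (Term.var s.grouped) < s.args.length :=
    List.idxOf_lt_length_iff.2 s.grouped_mem
  have h' : s.args.idxOf (Term.var s.grouped) < (s.args.map (Term.inst γ)).length := by
    simpa using h
  unfold Intensional.proj Intensional.inst
  rw [List.getD_eq_getElem _ _ h', List.getElem_map, List.getElem_idxOf]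
  rfl

open Classical in
/-- The instances of the grouped atom that are true in `M`. Every variable of the intensional
set/multiset occurs in its grouped atom, so these atoms correspond one-to-one to the ground
substitutions of the grouped and local variables that make the grouped atom true in `M`. -/
noncomputable def Intensional.support (s : Intensional K) (M : Finset (Atom K)) :
    Finset (Atom K) :=
  M.filter fun a => ∃ γ : ℕ → Const K, s.inst γ = a

/-- The interpretation of an intensional set/multiset: the set of values of the grouped
variable, respectively the multiset with one occurrence for each substitution. -/
noncomputable def Intensional.interp [DecidableEq K] (s : Intensional K) (M : Finset (Atom K)) :
    Multiset (Const K) :=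
  match s.kind with
  | .set => ((s.support M).image s.proj).val
  | .multiset => (s.support M).val.map s.proj

def Const.num? : Const K → Option K
  | .num x => some x
  | .sym _ => none

variable [Field K] [LinearOrder K]

/-- The value of an aggregate function, in `K` extended by `±∞`. `Count` is defined on all groups;
the others are undefined on groups with a non-numeric member. For the empty group, `Sum` and `Count`
are `0`, `Min` is `+∞`, `Max` is `-∞` and `Avg` is undefined. -/
noncomputable def AggFn.eval (f : AggFn) (g : Multiset (Const K)) :
    Option (WithBot (WithTop K)) :=
  let n : Multiset K := g.filterMap Const.num?
  let value (x : K) : WithBot (WithTop K) := ((x : WithTop K) : WithBot (WithTop K))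
  match f with
  | .count => some (value (Multiset.card g : K))
  | .sum => if ∀ c ∈ g, c.num? ≠ none then some (value n.sum) else none
  | .min => if ∀ c ∈ g, c.num? ≠ none then some (n.map value).inf else none
  | .max => if ∀ c ∈ g, c.num? ≠ none then some (n.map value).sup else none
  | .avg => if (∀ c ∈ g, c.num? ≠ none) ∧ g ≠ 0 then
      some (value (n.sum / (Multiset.card n : K))) else none

def RelOp.Holds {V : Type} [LinearOrder V] : RelOp → V → V → Prop
  | .eq, x, y => x = y
  | .ne, x, y => x ≠ y
  | .lt, x, y => x < y
  | .gt, x, y => y < x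
  | .le, x, y => x ≤ y
  | .ge, x, y => y ≤ x

/-- `M ⊨ l`; an aggregate atom whose aggregate is undefined is not satisfied. -/
def AggAtom.Sat (l : AggAtom K) (M : Finset (Atom K)) : Prop :=
  ∃ y, l.fn.eval (l.s.interp M) = some y ∧
    l.op.Holds y ((l.v : WithTop K) : WithBot (WithTop K))

/-- `H(l)`: the atoms of the Herbrand base `B` built from the grouped predicate of `l`. -/
def AggAtom.ext (l : AggAtom K) (B : Finset (Atom K)) : Finset (Atom K) :=
  B.filter fun a => a.pred = l.s.pred ∧ a.args.length = l.s.args.length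

/-- `⟨S₁, S₂⟩` is an aggregate solution of `l`, over the Herbrand base `B`. -/
def AggAtom.IsSolution (l : AggAtom K) (B S₁ S₂ : Finset (Atom K)) : Prop :=
  S₁ ⊆ l.ext B ∧ S₂ ⊆ l.ext B ∧ Disjoint S₁ S₂ ∧
    ∀ M ⊆ B, S₁ ⊆ M → S₂ ∩ M = ∅ → l.Sat M

/-! ### Fixpoint answer sets -/

/-- Conditional satisfaction `(I, M) ⊨ l`. -/
def AggAtom.CondSat (l : AggAtom K) (B I M : Finset (Atom K)) : Prop :=
  l.IsSolution B (I ∩ M ∩ l.ext B) (l.ext B \ M)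

/-- The reduct of a ground program with respect to `M`. -/
def reduct (P : List (Rule K)) (M : Finset (Atom K)) : List (Rule K) :=
  (P.filter fun r => decide (∀ b ∈ r.neg, b ∉ M)).map fun r => { r with neg := [] }

open Classical in
/-- The consequence operator `K_M^P`. -/
noncomputable def consequence (B : Finset (Atom K)) (P : List (Rule K)) (M I : Finset (Atom K)) :
    Finset (Atom K) :=
  (((reduct P M).filter fun r =>
    decide ((∀ a ∈ r.pos, a ∈ I) ∧ ∀ l ∈ r.aggs, l.CondSat B I M)).map Rule.head).toFinset

/-- `M` is the least fixpoint of `K_M^P` on the interpretations. -/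
def IsAnswerSet (B : Finset (Atom K)) (P : List (Rule K)) (M : Finset (Atom K)) : Prop :=
  IsLeast {I : Finset (Atom K) | I ⊆ B ∧ consequence B P M I = I} M

end Semantics

/-! ### The machine model

Programs of the textbook WHILE language over binary trees, whose leaves are `nil` or numbers. Number
operations are integer literals, `+`, `-`, `*` and `<`. The execution time counts every operation;
an arithmetic operation or comparison is charged in addition the weights of its operands. With weight
`0` this is the unit-cost real-number model. With the bit length as weight this is the
logarithmic-cost model, which is polynomially equivalent to Turing machines: trees are stored with
sharing, so that copying, pairing and taking components are constant-time pointer operations. -/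

inductive Data (K : Type) where
  | nil
  | num (x : K)
  | cons (a b : Data K)

inductive Expr where
  | var (i : ℕ)
  | nil
  | lit (z : ℤ)
  | cons (e f : Expr)
  | hd (e : Expr)
  | tl (e : Expr)
  | isNum (e : Expr)
  | add (e f : Expr)
  | sub (e f : Expr)
  | mul (e f : Expr)
  | lt (e f : Expr)

inductive Cmd where
  | skip
  | assign (i : ℕ) (e : Expr)
  | seq (c d : Cmd)
  | ite (e : Expr) (c d : Cmd)
  | loop (e : Expr) (c : Cmd)

section Machine

variable {K : Type}

abbrev Store (K : Type) := ℕ → Data K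

def Data.hd : Data K → Data K
  | .cons a _ => a
  | _ => .nil

def Data.tl : Data K → Data K
  | .cons _ b => b
  | _ => .nil

/-- Truth values: `nil` is false, everything else is true. -/
def Data.ofBool : Bool → Data K
  | true => .cons .nil .nil
  | false => .nil

def Data.isNum : Data K → Bool
  | .num _ => true
  | _ => false

/-- A binary number operation; the result is `nil` unless both operands are numbers. -/
def Data.op₂ (f : K → K → Data K) : Data K → Data K → Data K
  | .num x, .num y => f x y
  | _, _ => .nil

def Data.weight (w : K → ℕ) : Data K → ℕ
  | .num x => w x
  | _ => 0

def Expr.eval [Ring K] [LinearOrder K] (s : Store K) : Expr → Data K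
  | .var i => s i
  | .nil => .nil
  | .lit z => .num (z : K)
  | .cons e f => .cons (e.eval s) (f.eval s)
  | .hd e => (e.eval s).hd
  | .tl e => (e.eval s).tl
  | .isNum e => .ofBool (e.eval s).isNum
  | .add e f => Data.op₂ (fun x y => .num (x + y)) (e.eval s) (f.eval s)
  | .sub e f => Data.op₂ (fun x y => .num (x - y)) (e.eval s) (f.eval s)
  | .mul e f => Data.op₂ (fun x y => .num (x * y)) (e.eval s) (f.eval s)
  | .lt e f => Data.op₂ (fun x y => .ofBool (decide (x < y))) (e.eval s) (f.eval s)

/-- The time to evaluate an expression. -/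
def Expr.cost [Ring K] [LinearOrder K] (w : K → ℕ) (s : Store K) : Expr → ℕ
  | .var _ => 1
  | .nil => 1
  | .lit _ => 1
  | .cons e f => 1 + e.cost w s + f.cost w s
  | .hd e => 1 + e.cost w s
  | .tl e => 1 + e.cost w s
  | .isNum e => 1 + e.cost w s
  | .add e f | .sub e f | .mul e f | .lt e f =>
      1 + e.cost w s + f.cost w s + (e.eval s).weight w + (f.eval s).weight w

/-- `Exec w c s s' t`: started in store `s`, the command `c` terminates in store `s'` after
time `t`. -/
inductive Exec [Ring K] [LinearOrder K] (w : K → ℕ) : Cmd → Store K → Store K → ℕ → Prop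
  | skip (s : Store K) : Exec w .skip s s 1
  | assign (s : Store K) (i : ℕ) (e : Expr) :
      Exec w (.assign i e) s (Function.update s i (e.eval s)) (1 + e.cost w s)
  | seq {c d : Cmd} {s s₁ s₂ : Store K} {t₁ t₂ : ℕ} :
      Exec w c s s₁ t₁ → Exec w d s₁ s₂ t₂ → Exec w (.seq c d) s s₂ (t₁ + t₂)
  | iteTrue {e : Expr} {c d : Cmd} {s s₁ : Store K} {t : ℕ} :
      e.eval s ≠ .nil → Exec w c s s₁ t → Exec w (.ite e c d) s s₁ (1 + e.cost w s + t)
  | iteFalse {e : Expr} {c d : Cmd} {s s₁ : Store K} {t : ℕ} :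
      e.eval s = .nil → Exec w d s s₁ t → Exec w (.ite e c d) s s₁ (1 + e.cost w s + t)
  | loopTrue {e : Expr} {c : Cmd} {s s₁ s₂ : Store K} {t₁ t₂ : ℕ} :
      e.eval s ≠ .nil → Exec w c s s₁ t₁ → Exec w (.loop e c) s₁ s₂ t₂ →
        Exec w (.loop e c) s s₂ (1 + e.cost w s + t₁ + t₂)
  | loopFalse {e : Expr} {c : Cmd} {s : Store K} :
      e.eval s = .nil → Exec w (.loop e c) s s (1 + e.cost w s)

/-- The input is in variable `0`, all other variables are `nil`. -/
def inputStore (d : Data K) : Store K := fun i => if i = 0 then d else .nil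

/-- On input `d`, the program halts within time `n`, and it accepts (variable `1` is not `nil`) if
and only if `q` holds. -/
def Answers [Ring K] [LinearOrder K] (w : K → ℕ) (c : Cmd) (d : Data K) (n : ℕ) (q : Prop) :
    Prop :=
  ∃ (s : Store K) (t : ℕ), Exec w c (inputStore d) s t ∧ t ≤ n ∧ (s 1 ≠ .nil ↔ q)

/-- One program decides the problem `L` on all instances, in time polynomial in `size`. -/
def PolyTimeDecidable [Ring K] [LinearOrder K] {α : Type} (w : K → ℕ) (enc : α → Data K)
    (size : α → ℕ) (L : α → Prop) : Prop :=
  ∃ (c : Cmd) (p : Polynomial ℕ), ∀ x : α, Answers w c (enc x) (p.eval (size x)) (L x)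

/-- The unit-cost weight. -/
def unitCost (_ : K) : ℕ := 0

/-- The number of bits of a rational number. -/
def bits (x : ℚ) : ℕ := Nat.size x.num.natAbs + Nat.size x.den

/-- The size in bits of an input. -/
def Data.size : Data ℚ → ℕ
  | .nil => 1
  | .num x => 1 + bits x
  | .cons a b => 1 + a.size + b.size

/-- The complexity class P. -/
def InP {α : Type} (enc : α → Data ℚ) (L : α → Prop) : Prop :=
  PolyTimeDecidable bits enc (fun x => (enc x).size) L

/-- The complexity class NP: polynomial-time verification of certificates of polynomial size. -/
def InNP {α : Type} (enc : α → Data ℚ) (L : α → Prop) : Prop :=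
  ∃ (c : Cmd) (p q : Polynomial ℕ) (R : α → Data ℚ → Prop),
    (∀ (x : α) (y : Data ℚ), y.size ≤ q.eval (enc x).size →
      Answers bits c (.cons (enc x) y) (p.eval (enc x).size) (R x y)) ∧
    ∀ x : α, L x ↔ ∃ y : Data ℚ, y.size ≤ q.eval (enc x).size ∧ R x y

end Machine

/-! ### Encodings of the instances as trees -/

section Encodings

variable {K : Type}

def encList {α : Type} (f : α → Data K) (l : List α) : Data K :=
  l.foldr (fun a d => .cons (f a) d) .nil

variable [Field K]

def encNat (n : ℕ) : Data K := .num (n : K)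

def Const.enc : Const K → Data K
  | .num x => .num x
  | .sym n => .cons .nil (encNat n)

def Atom.enc (a : Atom K) : Data K := .cons (encNat a.pred) (encList Const.enc a.args)

def Term.enc : Term K → Data K
  | .var i => .cons .nil (encNat i)
  | .const c => .cons (encNat 1) c.enc

def Kind.enc : Kind → Data K
  | .set => encNat 0
  | .multiset => encNat 1

def Intensional.enc (s : Intensional K) : Data K :=
  .cons s.kind.enc (.cons (encNat s.grouped) (.cons (encNat s.pred) (encList Term.enc s.args)))

def AggFn.enc : AggFn → Data K
  | .sum => encNat 0
  | .count => encNat 1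
  | .min => encNat 2
  | .max => encNat 3
  | .avg => encNat 4

def RelOp.enc : RelOp → Data K
  | .eq => encNat 0
  | .ne => encNat 1
  | .lt => encNat 2
  | .gt => encNat 3
  | .le => encNat 4
  | .ge => encNat 5

def AggAtom.enc (l : AggAtom K) : Data K :=
  .cons l.fn.enc (.cons l.op.enc (.cons (.num l.v) l.s.enc))

def Rule.enc (r : Rule K) : Data K :=
  .cons r.head.enc (.cons (encList AggAtom.enc r.aggs)
    (.cons (encList Atom.enc r.pos) (encList Atom.enc r.neg)))

end Encodings

/-! ### The three decision problems -/

section Problems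

variable {K : Type} [Field K] [LinearOrder K]

/-- An instance of the solution checking problem: an aggregate atom `l` over a finite Herbrand base
`B`, and repetition-free listings of `H(l)` and of two disjoint subsets `I`, `J` of `H(l)`. -/
structure SolutionInstance (K : Type) [Field K] [LinearOrder K] where
  l : AggAtom K
  B : Finset (Atom K)
  H : List (Atom K)
  I : List (Atom K)
  J : List (Atom K)
  H_nodup : H.Nodup
  I_nodup : I.Nodup
  J_nodup : J.Nodup
  H_eq : H.toFinset = l.ext B
  I_sub : I ⊆ H
  J_sub : J ⊆ H
  disj : List.Disjoint I J

/-- The input consists of `l`, `H(l)`, `I` and `J`. -/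
def SolutionInstance.enc (x : SolutionInstance K) : Data K :=
  .cons x.l.enc (.cons (encList Atom.enc x.H)
    (.cons (encList Atom.enc x.I) (encList Atom.enc x.J)))

/-- The size of `H(l)`: its number of symbol occurrences, which is `(k + 1) |H(l)|` if the grouped
predicate has arity `k`. -/
def SolutionInstance.extSize (x : SolutionInstance K) : ℕ :=
  (x.l.s.args.length + 1) * (x.l.ext x.B).card

def SolutionInstance.Yes (x : SolutionInstance K) : Prop :=
  x.l.IsSolution x.B x.I.toFinset x.J.toFinset

/-- A ground program together with its finite Herbrand base. -/
structure Program (K : Type) where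
  base : List (Atom K)
  rules : List (Rule K)
  base_nodup : base.Nodup
  head_mem : ∀ r ∈ rules, r.head ∈ base
  pos_mem : ∀ r ∈ rules, ∀ a ∈ r.pos, a ∈ base
  neg_mem : ∀ r ∈ rules, ∀ a ∈ r.neg, a ∈ base

/-- No aggregate of the form `Sum(s) ≠ v` or `Avg(s) ≠ v` occurs in the program. -/
def Program.Tractable (P : Program K) : Prop :=
  ∀ r ∈ P.rules, ∀ l ∈ r.aggs, l.Tractable

def Program.enc (P : Program K) : Data K :=
  .cons (encList Atom.enc P.base) (encList Rule.enc P.rules)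

/-- An instance of answer set checking: a program and an interpretation `M` of it. -/
structure CheckInstance (K : Type) where
  P : Program K
  M : List (Atom K)
  M_nodup : M.Nodup
  M_sub : M ⊆ P.base

def CheckInstance.enc (x : CheckInstance K) : Data K :=
  .cons x.P.enc (encList Atom.enc x.M)

def CheckInstance.Yes (x : CheckInstance K) : Prop :=
  IsAnswerSet x.P.base.toFinset x.P.rules x.M.toFinset

def Program.HasAnswerSet (P : Program K) : Prop :=
  ∃ M : Finset (Atom K), IsAnswerSet P.base.toFinset P.rules M

end Problems

end AggSol

/-!
An admissible aggregate atom holds for all groups between a list `D` of decided members and `D ++ F`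
if and only if it holds at finitely many extremal groups that can be found without enumeration: the
sum ranges between the sums that add only the negative or only the positive part of `F`, the count
takes every value from `|D|` to `|D| + |F|`, and which values the minimum and the maximum take is
read off the lists. The average of a nonempty group `l` compares to `v` as the sum of the `x - v`
for `x` in `l` compares to `0`. For `≠` the values between the extremes matter; for sums and
averages this is the subset sum problem, hence the restriction on the atoms.

The operator `K_M^P` is monotone, so that its least fixpoint is reached from `∅` after as many steps
as there are atoms in the base. A certificate for an answer set is its list of truth values.

Running times compose because numbers have a subadditive magnitude that bounds the cost of
arithmetic: functions whose results have polynomial volume (nodes plus magnitudes) are closed under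
composition, and under iteration over a list if the state grows by a bounded amount per step. The
checks use only additions, subtractions and comparisons of numbers, never products or quotients.
-/

namespace AggSol

/-! ### Running programs -/

section Machine

variable {K : Type}

/-- Started in the store `s`, the program `c` halts within time `b` in a store with property `Q`. -/
def HaltsWithin [Ring K] [LinearOrder K] (w : K → ℕ) (c : Cmd) (s : Store K) (b : ℕ)
    (Q : Store K → Prop) : Prop :=
  ∃ (s' : Store K) (t : ℕ), Exec w c s s' t ∧ t ≤ b ∧ Q s'

/-- The calling convention of subroutines: between the stores `s` and `s'`, register `n` has
received the value `d`, and the registers below `n` have been preserved. -/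
def Returns (n : ℕ) (d : Data K) (s s' : Store K) : Prop :=
  s' n = d ∧ ∀ m < n, s' m = s m

/-- Runs the subroutine `c` of base register `m` on a copy of register `n`. -/
def Cmd.callOn (n m : ℕ) (c : Cmd) : Cmd := .seq (.assign m (.var n)) c

/-- One pass of a loop that folds the subroutine `c` of base register `n + 3` over a list: register
`n` holds a parameter, register `n + 1` the rest of the list and register `n + 2` the state. -/
def Cmd.foldlBody (n : ℕ) (c : Cmd) : Cmd :=
  .seq (.assign (n + 3) (.cons (.var n) (.cons (.var (n + 2)) (.hd (.var (n + 1))))))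
    (.seq c (.seq (.assign (n + 2) (.var (n + 3))) (.assign (n + 1) (.tl (.var (n + 1))))))

theorem Returns.update {n : ℕ} {s s' : Store K} (h : ∀ m < n, s' m = s m) (d : Data K) :
    Returns n d s (Function.update s' n d) :=
  ⟨by simp, fun m hm => by rw [Function.update_of_ne hm.ne, h m hm]⟩

namespace HaltsWithin

variable [Ring K] [LinearOrder K] {w : K → ℕ} {c d : Cmd} {s : Store K} {b b' : ℕ}
  {Q R : Store K → Prop}

theorem mono (h : HaltsWithin w c s b R) (hb : b ≤ b') (hRQ : ∀ s', R s' → Q s') :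
    HaltsWithin w c s b' Q :=
  let ⟨s', t, hc, ht, hR⟩ := h
  ⟨s', t, hc, ht.trans hb, hRQ s' hR⟩

theorem of_le (h : HaltsWithin w c s b Q) (hb : b ≤ b') : HaltsWithin w c s b' Q :=
  h.mono hb fun _ h => h

theorem assign {i : ℕ} {e : Expr} {v : Data K} (he : e.eval s = v)
    (h : Q (Function.update s i v)) : HaltsWithin w (.assign i e) s (1 + e.cost w s) Q :=
  ⟨_, _, .assign s i e, le_rfl, he ▸ h⟩

theorem seq (hc : HaltsWithin w c s b R) (hd : ∀ s', R s' → HaltsWithin w d s' b' Q) :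
    HaltsWithin w (.seq c d) s (b + b') Q :=
  let ⟨s₁, _, hc, ht₁, hR⟩ := hc
  let ⟨s₂, _, hd, ht₂, hQ⟩ := hd s₁ hR
  ⟨s₂, _, .seq hc hd, Nat.add_le_add ht₁ ht₂, hQ⟩

theorem assign_seq {i : ℕ} {e : Expr} {v : Data K} (he : e.eval s = v)
    (hd : HaltsWithin w d (Function.update s i v) b Q) :
    HaltsWithin w (.seq (.assign i e) d) s (1 + e.cost w s + b) Q :=
  seq (assign (Q := (· = _)) he rfl) (by rintro _ rfl; exact hd)

theorem ite_of_ne_nil {e : Expr} (he : e.eval s ≠ .nil) (hc : HaltsWithin w c s b Q) :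
    HaltsWithin w (.ite e c d) s (1 + e.cost w s + b) Q :=
  let ⟨s', _, hc, ht, hQ⟩ := hc
  ⟨s', _, .iteTrue he hc, Nat.add_le_add_left ht _, hQ⟩

theorem ite_of_eq_nil {e : Expr} (he : e.eval s = .nil) (hd : HaltsWithin w d s b Q) :
    HaltsWithin w (.ite e c d) s (1 + e.cost w s + b) Q :=
  let ⟨s', _, hd, ht, hQ⟩ := hd
  ⟨s', _, .iteFalse he hd, Nat.add_le_add_left ht _, hQ⟩

/-- `inv l s` is a loop invariant, in which the list `l` of the remaining iterations shrinks. -/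
theorem loop_list {α : Type} {i : ℕ} {inv : List α → Store K → Prop}
    (hguard : ∀ l s, inv l s → (s i = .nil ↔ l = []))
    (hbody : ∀ a l s, inv (a :: l) s → HaltsWithin w c s b (inv l)) {l : List α} (h : inv l s) :
    HaltsWithin w (.loop (.var i) c) s (l.length * (b + 2) + 2) (inv []) := by
  induction l generalizing s with
  | nil => exact ⟨s, _, .loopFalse ((hguard _ _ h).2 rfl), by simp [Expr.cost], h⟩
  | cons a l ih =>
    obtain ⟨s₁, t₁, hc, ht₁, h₁⟩ := hbody a l s h
    obtain ⟨s₂, t₂, hloop, ht₂, h₂⟩ := ih h₁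
    have hne : (Expr.var i).eval s ≠ .nil := fun h' => by simpa using (hguard _ _ h).1 h'
    refine ⟨s₂, _, .loopTrue hne hc hloop, ?_, h₂⟩
    simp only [Expr.cost, List.length_cons, Nat.add_mul]
    omega

theorem callOn {n m : ℕ} {v : Data K}
    (h : ∀ s' : Store K, s' m = s n → HaltsWithin w c s' b (Returns m v s')) :
    HaltsWithin w (c.callOn n m) s (b + 2) (Returns m v s) := by
  refine (assign_seq rfl (h (Function.update s m (s n)) (by simp))).mono ?_
    fun s' hs' => ⟨hs'.1, fun i hi => ?_⟩
  · simp only [Expr.cost]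
    omega
  · rw [hs'.2 i hi, Function.update_of_ne hi.ne]

theorem foldlBody {n : ℕ} {a r t t' : Data K} (hr : s (n + 1) = .cons a r) (ht : s (n + 2) = t)
    (hc : ∀ s' : Store K, s' (n + 3) = .cons (s n) (.cons t a) →
      HaltsWithin w c s' b (Returns (n + 3) t' s')) :
    HaltsWithin w (c.foldlBody n) s (b + 12)
      fun s' => s' (n + 1) = r ∧ s' (n + 2) = t' ∧ ∀ m ≤ n, s' m = s m := by
  set s₀ := Function.update s (n + 3) (.cons (s n) (.cons t a)) with hs₀
  have hkeep : ∀ m < n + 3, s₀ m = s m := fun m hm => Function.update_of_ne hm.ne _ _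
  have hinput : Expr.eval s (.cons (.var n) (.cons (.var (n + 2)) (.hd (.var (n + 1))))) =
      .cons (s n) (.cons t a) := by
    simp only [Expr.eval, hr, ht, Data.hd]
  refine of_le (assign_seq hinput (seq (b' := 5) (hc s₀ (by simp [hs₀])) fun s₁ h₁ =>
    of_le (assign_seq h₁.1 (assign (v := r) ?_ ⟨?_, ?_, fun m hm => ?_⟩)) ?_)) ?_
  · rw [Expr.eval, Expr.eval, Function.update_of_ne (by omega), h₁.2 _ (by omega),
      hkeep _ (by omega), hr, Data.tl]
  · simp
  · simp
  · rw [Function.update_of_ne (by omega), Function.update_of_ne (by omega), h₁.2 m (by omega),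
      hkeep m (by omega)]
  · simp only [Expr.cost]
    omega
  · simp only [Expr.cost]
    omega

theorem foldlLoop {σ α : Type} {code : α → Data K} {code' : σ → Data K} {n : ℕ} {l : List α}
    {start : σ} {step : σ → α → σ} (hl : s (n + 1) = encList code l) (hi : s (n + 2) = code' start)
    (hc : ∀ pre a, pre ++ [a] <+: l → ∀ s' : Store K,
      s' (n + 3) = .cons (s n) (.cons (code' (pre.foldl step start)) (code a)) →
      HaltsWithin w c s' b (Returns (n + 3) (code' ((pre ++ [a]).foldl step start)) s')) :
    HaltsWithin w (.loop (.var (n + 1)) (c.foldlBody n)) s (l.length * (b + 14) + 2)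
      fun s' => s' (n + 2) = code' (l.foldl step start) ∧ ∀ m ≤ n, s' m = s m := by
  refine (loop_list (inv := fun rest s' => s' (n + 1) = encList code rest ∧
    (∃ pre, pre ++ rest = l ∧ s' (n + 2) = code' (pre.foldl step start)) ∧ ∀ m ≤ n, s' m = s m)
    (b := b + 12) ?_ ?_ ⟨hl, ⟨[], rfl, hi⟩, fun _ _ => rfl⟩).mono le_rfl ?_
  · rintro (_ | ⟨a, rest⟩) s' ⟨h, -⟩ <;> simp [h, encList]
  · rintro a rest s' ⟨hrest, ⟨pre, hpre, hst⟩, hkeep⟩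
    refine (foldlBody hrest hst (t' := code' ((pre ++ [a]).foldl step start)) ?_).mono le_rfl ?_
    · rw [hkeep n le_rfl]
      exact hc pre a ⟨rest, by simpa using hpre⟩
    · rintro s'' ⟨h₁, h₂, h₃⟩
      exact ⟨h₁, ⟨pre ++ [a], by simpa using hpre, h₂⟩, fun m hm => (h₃ m hm).trans (hkeep m hm)⟩
  · rintro s' ⟨-, ⟨pre, hpre, hst⟩, hkeep⟩
    rw [List.append_nil] at hpre
    exact ⟨hpre ▸ hst, hkeep⟩

end HaltsWithin

end Machine

/-! ### Trees and codes -/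

/-- A weight for number operations together with a subadditive magnitude that controls it. -/
class CostModel (K : Type) [Ring K] where
  weight : K → ℕ
  mag : K → ℕ
  weight_le : ∀ x, weight x ≤ 2 * mag x
  mag_add : ∀ x y, mag (x + y) ≤ mag x + mag y
  mag_sub : ∀ x y, mag (x - y) ≤ mag x + mag y

/-- The representation of the elements of `α` by trees over `K`. -/
class TreeCode (K α : Type) where
  code : α → Data K

open TreeCode

section Code

variable {K α β : Type} [TreeCode K α] [TreeCode K β]

instance : TreeCode K Bool := ⟨Data.ofBool⟩

instance : TreeCode K K := ⟨Data.num⟩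

instance [Field K] : TreeCode K ℕ := ⟨encNat⟩

instance : TreeCode K (Data K) := ⟨id⟩

instance : TreeCode K (List α) := ⟨encList code⟩

instance : TreeCode K (α × β) := ⟨fun x => .cons (code x.1) (code x.2)⟩

theorem code_pair (x : α × β) : (code x : Data K) = .cons (code x.1) (code x.2) := rfl

theorem code_nil : (code ([] : List α) : Data K) = .nil := rfl

theorem code_cons (a : α) (l : List α) : (code (a :: l) : Data K) = .cons (code a) (code l) := rfl

theorem code_true : (code true : Data K) = .cons .nil .nil := rfl

theorem code_false : (code false : Data K) = .nil := rfl

theorem code_num (x : K) : (code x : Data K) = .num x := rfl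

theorem code_list_eq_nil {l : List α} : (code l : Data K) = .nil ↔ l = [] := by
  cases l <;> simp [code_nil, code_cons]

theorem code_bool_ne_nil {b : Bool} : (code b : Data K) ≠ .nil ↔ b = true := by
  cases b <;> simp [code_true, code_false]

/-- Whether a tree is different from `nil`. -/
def Data.truthy : Data K → Bool
  | .nil => false
  | _ => true

theorem Data.truthy_code_bool (b : Bool) : (code b : Data K).truthy = b := by cases b <;> rfl

/-- The subtree reached by descending to the first (`false`) or second (`true`) component. -/
def Data.path (d : Data K) : List Bool → Data K
  | [] => d
  | b :: π => Data.path (bif b then d.tl else d.hd) π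

/-- The expression that evaluates to the subtree `Data.path π` of the value of `e`. -/
def Expr.path (e : Expr) : List Bool → Expr
  | [] => e
  | b :: π => Expr.path (bif b then .tl e else .hd e) π

theorem Expr.eval_path [Ring K] [LinearOrder K] (s : Store K) (e : Expr) (π : List Bool) :
    (e.path π).eval s = (e.eval s).path π := by
  induction π generalizing e with
  | nil => rfl
  | cons b π ih => cases b <;> exact ih _

theorem Expr.cost_path [Ring K] [LinearOrder K] (w : K → ℕ) (s : Store K) (e : Expr)
    (π : List Bool) : (e.path π).cost w s = e.cost w s + π.length := by
  induction π generalizing e with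
  | nil => rfl
  | cons b π ih => cases b <;> simp [Expr.path, ih, Expr.cost] <;> omega

end Code

section Volume

variable {K : Type} [Ring K] [CostModel K] {α : Type} [TreeCode K α]

/-- The number of nodes of a tree plus the magnitudes of its numbers. -/
def Data.vol : Data K → ℕ
  | .nil => 1
  | .num x => 1 + CostModel.mag x
  | .cons a b => 1 + a.vol + b.vol

theorem Data.vol_hd_le (d : Data K) : d.hd.vol ≤ d.vol := by
  cases d <;> simp only [Data.vol, Data.hd] <;> omega

theorem Data.vol_tl_le (d : Data K) : d.tl.vol ≤ d.vol := by
  cases d <;> simp only [Data.vol, Data.tl] <;> omega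

theorem Data.vol_path_le (d : Data K) (π : List Bool) : (d.path π).vol ≤ d.vol := by
  induction π generalizing d with
  | nil => exact le_rfl
  | cons b π ih =>
    cases b
    · exact (ih _).trans d.vol_hd_le
    · exact (ih _).trans d.vol_tl_le

theorem Data.weight_le_vol (d : Data K) : d.weight CostModel.weight ≤ 2 * d.vol := by
  cases d with
  | num x =>
    have := CostModel.weight_le x
    simp only [Data.vol, Data.weight]
    omega
  | _ => simp [Data.weight]

theorem vol_code_bool_le (b : Bool) : (code b : Data K).vol ≤ 3 := by
  cases b <;> simp [code_true, code_false, Data.vol]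

theorem length_le_vol (l : List α) : l.length ≤ (code l : Data K).vol := by
  induction l with
  | nil => simp
  | cons a l ih =>
    simp only [code_cons, Data.vol, List.length_cons]
    omega

theorem vol_le_of_mem {l : List α} {a : α} (h : a ∈ l) :
    (code a : Data K).vol ≤ (code l : Data K).vol := by
  induction l with
  | nil => simp at h
  | cons b l ih =>
    simp only [code_cons, Data.vol]
    rcases List.mem_cons.1 h with rfl | h
    · omega
    · have := ih h
      omega

theorem vol_le_of_sublist {l l' : List α} (h : l.Sublist l') :
    (code l : Data K).vol ≤ (code l' : Data K).vol := by
  induction h with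
  | slnil => exact le_rfl
  | cons a _ ih | cons_cons a _ ih =>
    simp only [code_cons, Data.vol]
    omega

theorem vol_le_of_forall_le {l : List α} {b : ℕ} (h : ∀ a ∈ l, (code a : Data K).vol ≤ b) :
    (code l : Data K).vol ≤ 1 + l.length * (1 + b) := by
  induction l with
  | nil => simp [code_nil, Data.vol]
  | cons a l ih =>
    obtain ⟨ha, hl⟩ := List.forall_mem_cons.1 h
    have := ih hl
    simp only [code_cons, Data.vol, List.length_cons, Nat.add_mul]
    omega

theorem vol_triple_le {β γ : Type} [TreeCode K β] [TreeCode K γ] {a : α} {b : β} {c : γ}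
    {p q : Polynomial ℕ} (hb : (code b : Data K).vol ≤ p.eval (code a : Data K).vol)
    (hc : (code c : Data K).vol ≤ q.eval (code a : Data K).vol) :
    (code (a, b, c) : Data K).vol ≤ (2 + Polynomial.X + p + q).eval (code a : Data K).vol := by
  simp only [code_pair, Data.vol, Polynomial.eval_add, Polynomial.eval_ofNat, Polynomial.eval_X]
  omega

end Volume

theorem monotone_polynomial_eval {R : Type} [Semiring R] [PartialOrder R] [IsOrderedRing R]
    [CanonicallyOrderedAdd R] (p : Polynomial R) : Monotone fun x => p.eval x := by
  intro x y h
  simp only [Polynomial.eval_eq_sum]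
  exact Finset.sum_le_sum fun i _ =>
    mul_le_mul_of_nonneg_left (pow_le_pow_left₀ zero_le h i) zero_le

/-! ### Polynomial-time functions -/

section PolyTime

variable {K : Type} [Ring K] [LinearOrder K] [CostModel K]
  {α β γ ε σ : Type} [TreeCode K α] [TreeCode K β] [TreeCode K γ] [TreeCode K ε] [TreeCode K σ]

/-- `f` is computed in polynomial time with outputs of polynomial volume. For every register `n`
there is a program that reads its argument from `n`, leaves its result there, and preserves the
registers below `n`. -/
@[fun_prop]
def PolyTime (K : Type) [Ring K] [LinearOrder K] [CostModel K] {α β : Type} [TreeCode K α]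
    [TreeCode K β] (f : α → β) : Prop :=
  ∃ p : Polynomial ℕ,
    (∀ x, (code (f x) : Data K).vol ≤ p.eval (code x : Data K).vol) ∧
    ∀ n, ∃ c : Cmd, ∀ (s : Store K) (x : α), s n = code x →
      HaltsWithin CostModel.weight c s (p.eval (code x : Data K).vol) (Returns n (code (f x)) s)

namespace PolyTime

theorem of_expr {f : α → β} (e : ℕ → Expr) (p : Polynomial ℕ)
    (hv : ∀ x, (code (f x) : Data K).vol ≤ p.eval (code x : Data K).vol)
    (he : ∀ n (s : Store K) x, s n = code x → (e n).eval s = code (f x) ∧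
      (e n).cost CostModel.weight s ≤ p.eval (code x : Data K).vol) : PolyTime K f := by
  refine ⟨p + 1, fun x => (hv x).trans (by simp), fun n => ⟨.assign n (e n), fun s x hs => ?_⟩⟩
  obtain ⟨heval, hcost⟩ := he n s x hs
  refine (HaltsWithin.assign heval (Returns.update (fun _ _ => rfl) _)).of_le ?_
  simp only [Polynomial.eval_add, Polynomial.eval_one]
  omega

theorem of_path {f : α → β} (π : List Bool)
    (h : ∀ x, (code (f x) : Data K) = (code x : Data K).path π) : PolyTime K f := by
  refine of_expr (fun n => (Expr.var n).path π) (Polynomial.X + Polynomial.C (1 + π.length))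
    (fun x => ?_) fun n s x hs => ⟨?_, ?_⟩
  · rw [h]
    exact (Data.vol_path_le _ π).trans (by simp)
  · rw [Expr.eval_path, h, ← hs, Expr.eval]
  · rw [Expr.cost_path]
    simp [Expr.cost]

theorem of_code_eq {f : α → β} (h : ∀ x, (code (f x) : Data K) = code x) : PolyTime K f :=
  of_path [] h

theorem of_data {f : α → β} {d : α → Data K} (hd : PolyTime K d) (h : ∀ x, d x = code (f x)) :
    PolyTime K f := by
  obtain ⟨p, hp, hc⟩ := hd
  obtain rfl : d = fun x => code (f x) := funext h
  exact ⟨p, hp, hc⟩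

@[fun_prop]
theorem id : PolyTime K (fun x : α => x) := of_code_eq fun _ => rfl

@[fun_prop]
theorem comp {g : β → γ} {f : α → β} (hg : PolyTime K g) (hf : PolyTime K f) :
    PolyTime K (fun x => g (f x)) := by
  obtain ⟨p, hp, hc⟩ := hf
  obtain ⟨q, hq, hd⟩ := hg
  have hqp (x : α) : q.eval (code (f x) : Data K).vol ≤ q.eval (p.eval (code x : Data K).vol) :=
    monotone_polynomial_eval q (hp x)
  refine ⟨p + q.comp p, fun x => ?_, fun n => ?_⟩
  · have := (hq (f x)).trans (hqp x)
    simp only [Polynomial.eval_add, Polynomial.eval_comp]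
    omega
  · obtain ⟨c, hc⟩ := hc n
    obtain ⟨d, hd⟩ := hd n
    refine ⟨.seq c d, fun s x hs => ((hc s x hs).seq fun s₁ h₁ =>
      (hd s₁ (f x) h₁.1).mono (hqp x) fun s₂ h₂ => ?_).of_le (by simp)⟩
    exact ⟨h₂.1, fun m hm => (h₂.2 m hm).trans (h₁.2 m hm)⟩

@[fun_prop]
theorem pair {f : α → β} {g : α → γ} (hf : PolyTime K f) (hg : PolyTime K g) :
    PolyTime K (fun x => (f x, g x)) := by
  obtain ⟨p, hp, hc⟩ := hf
  obtain ⟨q, hq, hd⟩ := hg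
  refine ⟨p + q + 8, fun x => ?_, fun n => ?_⟩
  · have := hp x
    have := hq x
    simp only [code_pair, Data.vol, Polynomial.eval_add, Polynomial.eval_ofNat]
    omega
  · obtain ⟨c, hc⟩ := hc (n + 1)
    obtain ⟨d, hd⟩ := hd (n + 2)
    refine ⟨.seq (c.callOn n (n + 1)) (.seq (d.callOn n (n + 2))
      (.assign n (.cons (.var (n + 1)) (.var (n + 2))))), fun s x hs => ?_⟩
    refine .of_le (.seq (.callOn fun s' hs' => hc s' x (hs'.trans hs)) fun s₁ h₁ =>
      .seq (.callOn fun s' hs' => hd s' x ?_) fun s₂ h₂ =>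
        .of_le (b' := 4) (.assign ?_ (Returns.update (fun m hm => ?_) _)) le_rfl) ?_
    · rw [hs', h₁.2 n (by omega), hs]
    · rw [Expr.eval, Expr.eval, Expr.eval, h₂.1, h₂.2 (n + 1) (by omega), h₁.1, code_pair]
    · rw [h₂.2 m (by omega), h₁.2 m (by omega)]
    · simp only [Polynomial.eval_add, Polynomial.eval_ofNat]
      omega

@[fun_prop]
theorem fst {f : α → β × γ} (hf : PolyTime K f) : PolyTime K (fun x => (f x).1) :=
  comp (of_path (f := Prod.fst) [false] fun _ => rfl) hf

@[fun_prop]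
theorem snd {f : α → β × γ} (hf : PolyTime K f) : PolyTime K (fun x => (f x).2) :=
  comp (of_path (f := Prod.snd) [true] fun _ => rfl) hf

@[fun_prop]
theorem cond {c : α → Bool} {f g : α → β} (hc : PolyTime K c) (hf : PolyTime K f)
    (hg : PolyTime K g) : PolyTime K (fun x => bif c x then f x else g x) := by
  obtain ⟨r, -, hr⟩ := hc
  obtain ⟨p, hp, hc⟩ := hf
  obtain ⟨q, hq, hd⟩ := hg
  refine ⟨r + p + q + 4, fun x => ?_, fun n => ?_⟩
  · have := hp x
    have := hq x
    simp only [Polynomial.eval_add, Polynomial.eval_ofNat]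
    cases c x <;> simp only [cond_true, cond_false] <;> omega
  · obtain ⟨b, hb⟩ := hr (n + 1)
    obtain ⟨c₁, hc⟩ := hc n
    obtain ⟨c₂, hd⟩ := hd n
    refine ⟨.seq (b.callOn n (n + 1)) (.ite (.var (n + 1)) c₁ c₂), fun s x hs => ?_⟩
    refine .of_le (.seq (.callOn fun s' hs' => hb s' x (hs'.trans hs)) fun s₁ h₁ => ?_)
      (b := r.eval _ + 2 + (2 + (p.eval (code x : Data K).vol + q.eval (code x : Data K).vol))) ?_
    · have hn : s₁ n = code x := (h₁.2 n (by omega)).trans hs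
      have hkeep {m : ℕ} (hm : m < n) : s₁ m = s m := h₁.2 m (by omega)
      have hval : (Expr.var (n + 1)).eval s₁ = code (c x) := h₁.1
      cases h : c x
      · refine (HaltsWithin.ite_of_eq_nil (hval.trans (by rw [h, code_false])) (hd s₁ x hn)).mono
          (by simp only [Expr.cost]; omega) fun s₂ h₂ => ⟨by simpa [h] using h₂.1, fun m hm => ?_⟩
        rw [h₂.2 m hm, hkeep hm]
      · refine (HaltsWithin.ite_of_ne_nil (hval ▸ code_bool_ne_nil.2 h) (hc s₁ x hn)).mono
          (by simp only [Expr.cost]; omega) fun s₂ h₂ => ⟨by simpa [h] using h₂.1, fun m hm => ?_⟩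
        rw [h₂.2 m hm, hkeep hm]
    · simp only [Polynomial.eval_add, Polynomial.eval_ofNat]
      omega

theorem list_foldl_of_bound {L : ε → List α} {start : ε → σ} {step : ε → σ → α → σ}
    (hL : PolyTime K L) (hi : PolyTime K start)
    (hs : PolyTime K fun y : ε × σ × α => step y.1 y.2.1 y.2.2) (q : Polynomial ℕ)
    (hq : ∀ x l, l <+: L x →
      (code (l.foldl (step x) (start x)) : Data K).vol ≤ q.eval (code x : Data K).vol) :
    PolyTime K (fun x => (L x).foldl (step x) (start x)) := by
  obtain ⟨pL, hpL, hcL⟩ := hL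
  obtain ⟨pI, -, hcI⟩ := hi
  obtain ⟨pS, -, hcS⟩ := hs
  set pStep : Polynomial ℕ := pS.comp (2 + Polynomial.X + q + pL)
  have hstep (x : ε) (pre : List α) (a : α) (hpre : pre ++ [a] <+: L x) :
      pS.eval (code (x, pre.foldl (step x) (start x), a) : Data K).vol ≤
        pStep.eval (code x : Data K).vol := by
    have hst := hq x pre ((pre.prefix_append [a]).trans hpre)
    have ha : (code a : Data K).vol ≤ _ :=
      (vol_le_of_mem (hpre.subset (by simp))).trans (hpL x)
    rw [Polynomial.eval_comp]
    exact monotone_polynomial_eval pS (vol_triple_le hst ha)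
  refine ⟨q + pL + pI + pL * (pStep + 14) + 8, fun x => ?_, fun n => ?_⟩
  · have := hq x _ (List.prefix_refl _)
    simp only [Polynomial.eval_add]
    omega
  obtain ⟨cL, hcL⟩ := hcL (n + 1)
  obtain ⟨cI, hcI⟩ := hcI (n + 2)
  obtain ⟨cS, hcS⟩ := hcS (n + 3)
  refine ⟨.seq (cL.callOn n (n + 1)) (.seq (cI.callOn n (n + 2))
    (.seq (.loop (.var (n + 1)) (cS.foldlBody n)) (.assign n (.var (n + 2))))), fun s x hs => ?_⟩
  refine .of_le (.seq (.callOn fun s' hs' => hcL s' x (hs'.trans hs)) fun s₁ h₁ =>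
    .seq (.callOn fun s' hs' => hcI s' x ?_) fun s₂ h₂ => .seq (.foldlLoop (code := code)
      (code' := code) (l := L x) (step := step x) (b := pStep.eval (code x : Data K).vol) ?_ h₂.1
      fun pre a hpre s' hs' => ?_) fun s₃ h₃ =>
      .of_le (b' := 2) (.assign h₃.1 (Returns.update (fun m hm => ?_) _)) le_rfl) ?_
  · rw [hs', h₁.2 n (by omega), hs]
  · rw [h₂.2 (n + 1) (by omega), h₁.1]; rfl
  · rw [h₂.2 n (by omega), h₁.2 n (by omega), hs] at hs'
    rw [List.foldl_append]
    exact (hcS s' (x, _, a) hs').of_le (hstep x pre a hpre)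
  · rw [h₃.2 m hm.le, h₂.2 m (by omega), h₁.2 m (by omega)]
  · have hlen := (length_le_vol (K := K) (L x)).trans (hpL x)
    have := Nat.mul_le_mul_right (pStep.eval (code x : Data K).vol + 14) hlen
    simp only [Polynomial.eval_add, Polynomial.eval_ofNat, Polynomial.eval_mul]
    omega

theorem list_foldl_of_growth {L : ε → List α} {start : ε → σ} {step : ε → σ → α → σ}
    (hL : PolyTime K L) (hi : PolyTime K start)
    (hs : PolyTime K fun y : ε × σ × α => step y.1 y.2.1 y.2.2) (r : Polynomial ℕ)
    (hr : ∀ x st, ∀ a ∈ L x, (code (step x st a) : Data K).vol ≤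
      (code st : Data K).vol + r.eval (code x : Data K).vol) :
    PolyTime K (fun x => (L x).foldl (step x) (start x)) := by
  have ⟨pL, hpL, _⟩ := hL
  have ⟨pI, hpI, _⟩ := hi
  refine list_foldl_of_bound hL hi hs (pI + pL * r) fun x l hl => ?_
  have hgrowth (l : List α) (st : σ) (hl : l ⊆ L x) :
      (code (l.foldl (step x) st) : Data K).vol ≤
        (code st : Data K).vol + l.length * r.eval (code x : Data K).vol := by
    induction l generalizing st with
    | nil => simp
    | cons a l ih =>
      obtain ⟨ha, hl⟩ := List.cons_subset.1 hl
      have := ih (step x st a) hl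
      have := hr x st a ha
      rw [List.foldl_cons, List.length_cons, Nat.add_mul]
      omega
  have hlen := Nat.mul_le_mul_right (r.eval (code x : Data K).vol)
    (hl.length_le.trans ((length_le_vol (K := K) (L x)).trans (hpL x)))
  have := hgrowth l (start x) hl.subset
  have := hpI x
  simp only [Polynomial.eval_add, Polynomial.eval_mul]
  omega

end PolyTime

end PolyTime

section Combinators

variable {K : Type} [Ring K] [LinearOrder K] [CostModel K]
  {α β γ ε σ : Type} [TreeCode K α] [TreeCode K β] [TreeCode K γ] [TreeCode K ε] [TreeCode K σ]

/-- Constants that can be written down in a program. -/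
class Literal (K : Type) [Ring K] [LinearOrder K] [CostModel K] {β : Type} [TreeCode K β]
    (b : β) : Prop where
  exists_expr : ∃ (e : Expr) (k : ℕ), ∀ s : Store K,
    e.eval s = code b ∧ e.cost CostModel.weight s ≤ k

instance (b : Bool) : Literal K b :=
  match b with
  | false => ⟨.nil, 1, fun _ => ⟨rfl, le_rfl⟩⟩
  | true => ⟨.cons .nil .nil, 3, fun _ => ⟨rfl, le_rfl⟩⟩

instance : Literal K (0 : K) := ⟨.lit 0, 1, fun _ => ⟨congrArg Data.num Int.cast_zero, le_rfl⟩⟩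

instance : Literal K (1 : K) := ⟨.lit 1, 1, fun _ => ⟨congrArg Data.num Int.cast_one, le_rfl⟩⟩

instance : Literal K ([] : List α) := ⟨.nil, 1, fun _ => ⟨rfl, le_rfl⟩⟩

namespace PolyTime

@[fun_prop]
theorem const (b : β) [h : Literal K b] : PolyTime K (fun _ : α => b) := by
  obtain ⟨e, k, h⟩ := h
  exact of_expr (fun _ => e) (Polynomial.C (k + (code b : Data K).vol)) (by simp)
    fun n s x _ => ⟨(h s).1, (h s).2.trans (by simp)⟩

@[fun_prop]
theorem code {f : α → β} (hf : PolyTime K f) : PolyTime K (fun x => (code (f x) : Data K)) :=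
  comp (of_code_eq (f := fun b : β => (TreeCode.code b : Data K)) fun _ => rfl) hf

@[fun_prop]
theorem data_hd {f : α → Data K} (hf : PolyTime K f) : PolyTime K (fun x => (f x).hd) :=
  comp (of_path (f := Data.hd) [false] fun _ => rfl) hf

@[fun_prop]
theorem data_tl {f : α → Data K} (hf : PolyTime K f) : PolyTime K (fun x => (f x).tl) :=
  comp (of_path (f := Data.tl) [true] fun _ => rfl) hf

@[fun_prop]
theorem data_truthy {f : α → Data K} (hf : PolyTime K f) : PolyTime K (fun x => (f x).truthy) := by
  refine comp (g := Data.truthy) ⟨10, fun d => (vol_code_bool_le _).trans (by simp), fun n =>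
    ⟨.ite (.var n) (.assign n (.cons .nil .nil)) (.assign n .nil), fun s d hs => ?_⟩⟩ hf
  replace hs : (Expr.var n).eval s = d := hs
  have hreturn (v : Data K) : Returns n v s (Function.update s n v) :=
    Returns.update (fun _ _ => rfl) v
  cases h : d.truthy
  · have hnil : d = .nil := by cases d <;> simp_all [Data.truthy]
    exact (HaltsWithin.ite_of_eq_nil (hs.trans hnil) (.assign rfl (hreturn _))).of_le
      (by simp [Expr.cost])
  · have hne : d ≠ .nil := by rintro rfl; simp [Data.truthy] at h
    exact (HaltsWithin.ite_of_ne_nil (hs ▸ hne) (.assign rfl (hreturn _))).of_le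
      (by simp [Expr.cost])

@[fun_prop]
theorem not {f : α → Bool} (hf : PolyTime K f) : PolyTime K (fun x => !f x) := by
  have (x : α) : (!f x) = bif f x then false else true := by cases f x <;> rfl
  simp only [this]
  fun_prop

@[fun_prop]
theorem and {f g : α → Bool} (hf : PolyTime K f) (hg : PolyTime K g) :
    PolyTime K (fun x => f x && g x) := by
  have (x : α) : (f x && g x) = bif f x then g x else false := by cases f x <;> rfl
  simp only [this]
  fun_prop

@[fun_prop]
theorem or {f g : α → Bool} (hf : PolyTime K f) (hg : PolyTime K g) :
    PolyTime K (fun x => f x || g x) := by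
  have (x : α) : (f x || g x) = bif f x then true else g x := by cases f x <;> rfl
  simp only [this]
  fun_prop

theorem of_op₂ {g : K → K → β} (e : Expr → Expr → Expr)
    (heval : ∀ (s : Store K) e₁ e₂ x y, e₁.eval s = .num x → e₂.eval s = .num y →
      (e e₁ e₂).eval s = TreeCode.code (g x y))
    (hcost : ∀ (w : K → ℕ) (s : Store K) e₁ e₂, (e e₁ e₂).cost w s =
      1 + e₁.cost w s + e₂.cost w s + (e₁.eval s).weight w + (e₂.eval s).weight w)
    (hvol : ∀ x y, (TreeCode.code (g x y) : Data K).vol ≤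
      3 + CostModel.mag x + CostModel.mag y) :
    PolyTime K (fun z : K × K => g z.1 z.2) := by
  refine of_expr (fun n => e (.hd (.var n)) (.tl (.var n))) (4 * Polynomial.X + 5) (fun z => ?_)
    fun n s z hs => ⟨?_, ?_⟩
  · have := hvol z.1 z.2
    simp only [code_pair, Data.vol, code_num, Polynomial.eval_add, Polynomial.eval_mul,
      Polynomial.eval_ofNat, Polynomial.eval_X]
    omega
  · apply heval <;> simp only [Expr.eval, hs] <;> rfl
  · have h₁ := Data.weight_le_vol (K := K) (.num z.1)
    have h₂ := Data.weight_le_vol (K := K) (.num z.2)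
    simp only [hcost, Expr.cost, Expr.eval, hs, code_pair, Data.vol, code_num, Data.hd, Data.tl,
      Polynomial.eval_add, Polynomial.eval_mul, Polynomial.eval_ofNat,
      Polynomial.eval_X] at h₁ h₂ ⊢
    omega

@[fun_prop]
theorem add {f g : α → K} (hf : PolyTime K f) (hg : PolyTime K g) :
    PolyTime K (fun x => f x + g x) := by
  refine comp (g := fun z : K × K => z.1 + z.2) (of_op₂ (g := fun x y => x + y) .add ?_
    (fun _ _ _ _ => rfl) fun x y => ?_) (pair hf hg)
  · intro s e₁ e₂ x y h₁ h₂
    rw [Expr.eval, h₁, h₂, Data.op₂, code_num]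
  · have := CostModel.mag_add x y
    simp only [code_num, Data.vol]
    omega

@[fun_prop]
theorem sub {f g : α → K} (hf : PolyTime K f) (hg : PolyTime K g) :
    PolyTime K (fun x => f x - g x) := by
  refine comp (g := fun z : K × K => z.1 - z.2) (of_op₂ (g := fun x y => x - y) .sub ?_
    (fun _ _ _ _ => rfl) fun x y => ?_) (pair hf hg)
  · intro s e₁ e₂ x y h₁ h₂
    rw [Expr.eval, h₁, h₂, Data.op₂, code_num]
  · have := CostModel.mag_sub x y
    simp only [code_num, Data.vol]
    omega

@[fun_prop]
theorem decide_lt {f g : α → K} (hf : PolyTime K f) (hg : PolyTime K g) :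
    PolyTime K (fun x => decide (f x < g x)) := by
  refine comp (g := fun z : K × K => decide (z.1 < z.2))
    (of_op₂ (g := fun x y => decide (x < y)) .lt ?_ (fun _ _ _ _ => rfl) fun x y => ?_)
    (pair hf hg)
  · intro s e₁ e₂ x y h₁ h₂
    rw [Expr.eval, h₁, h₂]
    rfl
  · exact (vol_code_bool_le _).trans (by omega)

@[fun_prop]
theorem decide_le {f g : α → K} (hf : PolyTime K f) (hg : PolyTime K g) :
    PolyTime K (fun x => decide (f x ≤ g x)) := by
  simp only [← not_lt, decide_not]
  fun_prop

@[fun_prop]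
theorem list_cons {f : α → β} {g : α → List β} (hf : PolyTime K f) (hg : PolyTime K g) :
    PolyTime K (fun x => f x :: g x) :=
  comp (of_code_eq (f := fun z : β × List β => z.1 :: z.2) fun _ => rfl) (pair hf hg)

@[fun_prop]
theorem list_tail {f : α → List β} (hf : PolyTime K f) : PolyTime K (fun x => (f x).tail) :=
  comp (of_path (f := List.tail) [true] fun l => by cases l <;> rfl) hf

@[fun_prop]
theorem list_isEmpty {f : α → List β} (hf : PolyTime K f) :
    PolyTime K (fun x => (f x).isEmpty) := by
  have (x : α) : (f x).isEmpty = !(TreeCode.code (f x) : Data K).truthy := by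
    cases f x <;> rfl
  simp only [this]
  fun_prop

@[fun_prop]
theorem list_headD {f : α → List β} {b : α → β} (hf : PolyTime K f) (hb : PolyTime K b) :
    PolyTime K (fun x => (f x).headD (b x)) := by
  refine of_data (cond (list_isEmpty hf) (code hb) (data_hd (code hf))) fun x => ?_
  cases f x <;> rfl

@[fun_prop]
theorem list_any {L : ε → List α} {p : ε → α → Bool} (hL : PolyTime K L)
    (hp : PolyTime K fun y : ε × α => p y.1 y.2) : PolyTime K (fun x => (L x).any (p x)) := by
  have hfold (l : List α) (p : α → Bool) (b : Bool) :
      l.foldl (fun b a => b || p a) b = (b || l.any p) := by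
    induction l generalizing b with
    | nil => simp
    | cons a l ih => simp [ih, Bool.or_assoc]
  have (x : ε) : (L x).any (p x) = (L x).foldl (fun b a => b || p x a) false := by simp [hfold]
  simp only [this]
  refine list_foldl_of_bound (step := fun x b a => b || p x a) hL (by fun_prop) ?_ 3
    fun x l _ => by simpa using vol_code_bool_le _
  exact or (by fun_prop) (hp.comp (f := fun y : ε × Bool × α => (y.1, y.2.2)) (by fun_prop))

@[fun_prop]
theorem list_all {L : ε → List α} {p : ε → α → Bool} (hL : PolyTime K L)
    (hp : PolyTime K fun y : ε × α => p y.1 y.2) : PolyTime K (fun x => (L x).all (p x)) := by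
  simp only [List.all_eq_not_any_not]
  exact not (list_any hL (not hp))

@[fun_prop]
theorem list_reverse {f : α → List β} (hf : PolyTime K f) :
    PolyTime K (fun x => (f x).reverse) := by
  have (x : α) : (f x).reverse = (f x).foldl (fun l a => a :: l) [] := by simp
  simp only [this]
  have ⟨p, hp, _⟩ := hf
  refine list_foldl_of_growth (step := fun _ l a => a :: l) hf (by fun_prop) (by fun_prop)
    (p + 1) fun x l a ha => ?_
  have := (vol_le_of_mem (K := K) ha).trans (hp x)
  simp only [code_cons, Data.vol, Polynomial.eval_add, Polynomial.eval_one]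
  omega

theorem list_foldr_of_growth {L : ε → List α} {start : ε → σ} {step : ε → α → σ → σ}
    (hL : PolyTime K L) (hi : PolyTime K start)
    (hs : PolyTime K fun y : ε × σ × α => step y.1 y.2.2 y.2.1) (r : Polynomial ℕ)
    (hr : ∀ x st, ∀ a ∈ L x, (TreeCode.code (step x a st) : Data K).vol ≤
      (TreeCode.code st : Data K).vol + r.eval (TreeCode.code x : Data K).vol) :
    PolyTime K (fun x => (L x).foldr (step x) (start x)) := by
  have (x : ε) : (L x).foldr (step x) (start x) =
      (L x).reverse.foldl (fun st a => step x a st) (start x) := by simp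
  simp only [this]
  exact list_foldl_of_growth (step := fun x st a => step x a st) (list_reverse hL) hi hs r
    fun x st a ha => hr x st a (by simpa using ha)

@[fun_prop]
theorem list_append {f g : α → List β} (hf : PolyTime K f) (hg : PolyTime K g) :
    PolyTime K (fun x => f x ++ g x) := by
  have (x : α) : f x ++ g x = (f x).foldr (fun a l => a :: l) (g x) := by simp
  simp only [this]
  have ⟨p, hp, _⟩ := hf
  refine list_foldr_of_growth (step := fun _ a l => a :: l) hf hg (by fun_prop) (p + 1)
    fun x l a ha => ?_
  have := (vol_le_of_mem (K := K) ha).trans (hp x)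
  simp only [code_cons, Data.vol, Polynomial.eval_add, Polynomial.eval_one]
  omega

@[fun_prop]
theorem list_map {L : ε → List α} {f : ε → α → β} (hL : PolyTime K L)
    (hf : PolyTime K fun y : ε × α => f y.1 y.2) : PolyTime K (fun x => (L x).map (f x)) := by
  simp only [List.map_eq_foldr]
  have ⟨p, hp, _⟩ := hL
  have ⟨q, hq, _⟩ := hf
  refine list_foldr_of_growth (step := fun x a l => f x a :: l) hL (by fun_prop) ?_
    (q.comp (1 + Polynomial.X + p) + 1) fun x l a ha => ?_
  · exact list_cons (hf.comp (f := fun y : ε × List β × α => (y.1, y.2.2)) (by fun_prop))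
      (by fun_prop)
  · have hinput : (TreeCode.code (x, a) : Data K).vol ≤
        (1 + Polynomial.X + p).eval (TreeCode.code x : Data K).vol := by
      have := (vol_le_of_mem (K := K) ha).trans (hp x)
      simp only [code_pair, Data.vol, Polynomial.eval_add, Polynomial.eval_one, Polynomial.eval_X]
      omega
    have : (TreeCode.code (f x a) : Data K).vol ≤ _ :=
      (hq (x, a)).trans (monotone_polynomial_eval q hinput)
    simp only [code_cons, Data.vol, Polynomial.eval_add, Polynomial.eval_one, Polynomial.eval_comp]
      at this ⊢
    omega

@[fun_prop]
theorem list_filter {L : ε → List α} {p : ε → α → Bool} (hL : PolyTime K L)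
    (hp : PolyTime K fun y : ε × α => p y.1 y.2) : PolyTime K (fun x => (L x).filter (p x)) := by
  have hfold (l : List α) (p : α → Bool) :
      l.filter p = l.foldr (fun a l => bif p a then a :: l else l) [] := by
    induction l with
    | nil => rfl
    | cons a l ih => cases h : p a <;> simp [h, ih]
  simp only [hfold]
  have ⟨r, hr, _⟩ := hL
  refine list_foldr_of_growth (step := fun x a l => bif p x a then a :: l else l) hL
    (by fun_prop) ?_ (r + 1) fun x l a ha => ?_
  · exact cond (hp.comp (f := fun y : ε × List α × α => (y.1, y.2.2)) (by fun_prop))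
      (by fun_prop) (by fun_prop)
  · have := (vol_le_of_mem (K := K) ha).trans (hr x)
    simp only [Polynomial.eval_add, Polynomial.eval_one]
    cases p x a <;> simp only [cond_false, cond_true, code_cons, Data.vol] <;> omega

@[fun_prop]
theorem list_zip {f : α → List β} {g : α → List γ} (hf : PolyTime K f) (hg : PolyTime K g) :
    PolyTime K (fun x => (f x).zip (g x)) := by
  let step (st : List γ × List (β × γ)) (b : β) : List γ × List (β × γ) :=
    match st.1 with
    | [] => st
    | c :: l => (l, (b, c) :: st.2)
  have hfold (l : List β) (st : List γ × List (β × γ)) :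
      (l.foldl step st).2.reverse = st.2.reverse ++ l.zip st.1 := by
    induction l generalizing st with
    | nil => simp
    | cons b l ih => obtain ⟨_ | ⟨c, l'⟩, acc⟩ := st <;> simp [ih, step]
  have hstep : PolyTime K fun y : (List γ × List (β × γ)) × β => step y.1 y.2 := by
    refine of_data (d := fun y => bif y.1.1.isEmpty then TreeCode.code y.1 else
      TreeCode.code (y.1.1.tail, ((y.2, (TreeCode.code y.1.1 : Data K).hd), y.1.2)))
      (by fun_prop) fun y => ?_
    obtain ⟨⟨_ | ⟨c, l⟩, acc⟩, b⟩ := y <;> rfl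
  have (x : α) : (f x).zip (g x) = ((f x).foldl step (g x, [])).2.reverse := by simp [hfold]
  simp only [this]
  have ⟨p, hp, _⟩ := hf
  refine list_reverse (snd (list_foldl_of_growth (step := fun _ => step) hf (by fun_prop)
    (hstep.comp (snd .id)) (p + 1) fun x st b hb => ?_))
  have := (vol_le_of_mem (K := K) hb).trans (hp x)
  simp only [Polynomial.eval_add, Polynomial.eval_one]
  obtain ⟨_ | ⟨c, l⟩, acc⟩ := st <;> simp only [step, code_pair, code_cons, Data.vol] <;> omega

@[fun_prop]
theorem list_sum {f : α → List K} (hf : PolyTime K f) : PolyTime K (fun x => (f x).sum) := by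
  have (x : α) : (f x).sum = (f x).foldr (fun a s => a + s) 0 := rfl
  simp only [this]
  have ⟨p, hp, _⟩ := hf
  refine list_foldr_of_growth (step := fun _ a s => a + s) hf (by fun_prop) (by fun_prop) p
    fun x s a ha => ?_
  have := (vol_le_of_mem (K := K) ha).trans (hp x)
  have := CostModel.mag_add a s
  simp only [code_num, Data.vol] at *
  omega

@[fun_prop]
theorem natCast_list_length {f : α → List β} (hf : PolyTime K f) :
    PolyTime K (fun x => ((f x).length : K)) := by
  have (x : α) : ((f x).length : K) = ((f x).map fun _ => (1 : K)).sum := by simp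
  simp only [this]
  fun_prop

end PolyTime

end Combinators

/-! ### Equality and syntax -/

section Equality

variable {K : Type} [Ring K] [LinearOrder K] [CostModel K]
  {α β ε : Type} [TreeCode K α] [TreeCode K β] [TreeCode K ε]

/-- Equality on `α` is decided in polynomial time. -/
class PolyTimeEq (K : Type) [Ring K] [LinearOrder K] [CostModel K] (α : Type) [TreeCode K α]
    [DecidableEq α] : Prop where
  polyTime : PolyTime K fun z : α × α => decide (z.1 = z.2)

namespace PolyTime

@[fun_prop]
theorem decide_eq [DecidableEq α] [h : PolyTimeEq K α] {f g : ε → α} (hf : PolyTime K f)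
    (hg : PolyTime K g) : PolyTime K (fun x => decide (f x = g x)) :=
  comp h.polyTime (pair hf hg)

@[fun_prop]
theorem decide_mem [DecidableEq α] [PolyTimeEq K α] {f : ε → α} {l : ε → List α}
    (hf : PolyTime K f) (hl : PolyTime K l) : PolyTime K (fun x => decide (f x ∈ l x)) := by
  have (x : ε) : decide (f x ∈ l x) = (l x).any fun a => decide (f x = a) := by
    rw [Bool.eq_iff_iff]
    simp
  simp only [this]
  fun_prop

theorem list_drop_idxOf [DecidableEq α] [PolyTimeEq K α] {l : ε → List α} {a : ε → α}
    {m : ε → List β} (hl : PolyTime K l) (ha : PolyTime K a) (hm : PolyTime K m) :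
    PolyTime K (fun x => (m x).drop ((l x).idxOf (a x))) := by
  let step (a : α) (st : Bool × List β) (b : α) : Bool × List β :=
    bif st.1 || decide (b = a) then (true, st.2) else (false, st.2.tail)
  have hfold (a : α) (l : List α) (st : Bool × List β) :
      (l.foldl (step a) st).2 = bif st.1 then st.2 else st.2.drop (l.idxOf a) := by
    induction l generalizing st with
    | nil => cases st.1 <;> simp
    | cons b l ih =>
      cases h : st.1 <;> by_cases hb : b = a <;> simp [h, hb, ih, step, List.idxOf_cons_ne]
  have (x : ε) : (m x).drop ((l x).idxOf (a x)) = ((l x).foldl (step (a x)) (false, m x)).2 := by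
    rw [hfold, cond_false]
  simp only [this]
  refine snd (list_foldl_of_growth (step := fun x => step (a x)) hl (by fun_prop) (by fun_prop) 2
    fun x st b _ => ?_)
  have htail := Data.vol_tl_le (TreeCode.code st.2 : Data K)
  have htl : (TreeCode.code st.2 : Data K).tl = TreeCode.code st.2.tail := by
    rcases st.2 with _ | _ <;> rfl
  rw [htl] at htail
  obtain ⟨_ | _, rest⟩ := st <;> by_cases hb : b = a x <;>
    simp_all only [step, Bool.or_true, Bool.or_false, decide_true, decide_false,
      cond_true, cond_false, code_pair, code_true, code_false, Data.vol, Polynomial.eval_ofNat] <;>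
    omega

@[fun_prop]
theorem list_getD_idxOf [DecidableEq α] [PolyTimeEq K α] {l : ε → List α} {a : ε → α}
    {m : ε → List β} {d : ε → β} (hl : PolyTime K l) (ha : PolyTime K a) (hm : PolyTime K m)
    (hd : PolyTime K d) : PolyTime K (fun x => (m x).getD ((l x).idxOf (a x)) (d x)) := by
  have (x : ε) : (m x).getD ((l x).idxOf (a x)) (d x) =
      ((m x).drop ((l x).idxOf (a x))).headD (d x) := by
    rw [List.headD_eq_head?_getD, List.head?_drop, List.getD_eq_getElem?_getD]
  simp only [this]
  exact list_headD (list_drop_idxOf hl ha hm) hd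

end PolyTime

namespace PolyTimeEq

theorem of_injective [DecidableEq α] [DecidableEq β] [PolyTimeEq K β] {f : α → β}
    (hinj : f.Injective) (hf : PolyTime K f) : PolyTimeEq K α where
  polyTime := by
    simp only [← hinj.eq_iff]
    fun_prop

instance : PolyTimeEq K Bool where
  polyTime := by
    have (z : Bool × Bool) : decide (z.1 = z.2) = bif z.1 then z.2 else !z.2 := by
      obtain ⟨_ | _, _ | _⟩ := z <;> rfl
    simp only [this]
    fun_prop

instance : PolyTimeEq K K where
  polyTime := by
    simp only [le_antisymm_iff, Bool.decide_and]
    fun_prop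

instance [DecidableEq α] [DecidableEq β] [PolyTimeEq K α] [PolyTimeEq K β] :
    PolyTimeEq K (α × β) where
  polyTime := by
    simp only [Prod.ext_iff, Bool.decide_and]
    fun_prop

instance [CharZero K] [DecidableEq α] [PolyTimeEq K α] : PolyTimeEq K (List α) where
  polyTime := by
    have (z : List α × List α) : decide (z.1 = z.2) =
        (decide ((z.1.length : K) = z.2.length) &&
          (z.1.zip z.2).all fun y => decide (y.1 = y.2)) := by
      rw [Bool.eq_iff_iff]
      simp [← List.forall₂_eq_eq_eq, List.forall₂_iff_zip]
    simp only [this]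
    fun_prop

end PolyTimeEq

end Equality

section SyntaxCodes

variable {K : Type}

/-- Whether a constant is an uninterpreted symbol. -/
def Const.isSym : Const K → Bool
  | .num _ => false
  | .sym _ => true

/-- Whether a term is a constant. -/
def Term.isConst : Term K → Bool
  | .const _ => true
  | .var _ => false

/-- The substitution under which the grouped atom of `s` can only become `a`. The value of a
variable that does not occur there is arbitrary. -/
def Intensional.unifier [DecidableEq K] (s : Intensional K) (a : Atom K) (i : ℕ) : Const K :=
  a.args.getD (s.args.idxOf (Term.var i)) (Const.sym 0)

/-- Whether `a` is an instance of the grouped atom of `s`. -/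
def Intensional.matches [DecidableEq K] (s : Intensional K) (a : Atom K) : Bool :=
  decide (s.inst (s.unifier a) = a)

theorem Intensional.unifier_inst [DecidableEq K] (s : Intensional K) (γ : ℕ → Const K) {i : ℕ}
    (hi : Term.var i ∈ s.args) : s.unifier (s.inst γ) i = γ i := by
  have h : s.args.idxOf (Term.var i) < s.args.length := List.idxOf_lt_length_iff.2 hi
  unfold Intensional.unifier Intensional.inst
  rw [List.getD_eq_getElem _ _ (by simpa using h), List.getElem_map, List.getElem_idxOf]
  rfl

theorem Intensional.matches_iff [DecidableEq K] {s : Intensional K} {a : Atom K} :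
    s.matches a ↔ ∃ γ, s.inst γ = a := by
  refine ⟨fun h => ⟨_, of_decide_eq_true h⟩, ?_⟩
  rintro ⟨γ, rfl⟩
  refine decide_eq_true (congrArg (Atom.mk s.pred) (List.map_congr_left fun t ht => ?_))
  cases t with
  | const c => rfl
  | var i => exact s.unifier_inst γ ht

/-- Case distinction on a relational operator. -/
def RelOp.elim {β : Type} (op : RelOp) (eq ne lt gt le ge : β) : β :=
  match op with
  | .eq => eq
  | .ne => ne
  | .lt => lt
  | .gt => gt
  | .le => le
  | .ge => ge

/-- Case distinction on an aggregate function. -/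
def AggFn.elim {β : Type} (fn : AggFn) (sum count min max avg : β) : β :=
  match fn with
  | .sum => sum
  | .count => count
  | .min => min
  | .max => max
  | .avg => avg

variable [Field K]

/-- The number in a constant, or the index of a symbol. -/
def Const.val : Const K → K
  | .num x => x
  | .sym n => n

/-- The constant in a term, or the index of a variable as a number. -/
def Term.toConst : Term K → Const K
  | .const c => c
  | .var i => .num i

instance : TreeCode K (Const K) := ⟨Const.enc⟩

instance : TreeCode K (Atom K) := ⟨Atom.enc⟩

instance : TreeCode K (Term K) := ⟨Term.enc⟩

instance : TreeCode K (Intensional K) := ⟨Intensional.enc⟩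

instance : TreeCode K AggFn := ⟨AggFn.enc⟩

instance : TreeCode K RelOp := ⟨RelOp.enc⟩

instance : TreeCode K (AggAtom K) := ⟨AggAtom.enc⟩

instance : TreeCode K (Rule K) := ⟨Rule.enc⟩

variable [LinearOrder K] [CostModel K] {ε β : Type} [TreeCode K ε] [TreeCode K β]

instance (n : ℕ) : Literal K n := ⟨.lit n, 1, fun _ => ⟨congrArg Data.num (by simp), le_rfl⟩⟩

instance : Literal K (Const.sym 0 : Const K) :=
  ⟨.cons .nil (.lit 0), 3, fun _ => ⟨congrArg (Data.cons .nil ∘ Data.num) (by simp), le_rfl⟩⟩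

namespace PolyTime

@[fun_prop]
theorem natCast {f : ε → ℕ} (hf : PolyTime K f) : PolyTime K (fun x => (f x : K)) :=
  comp (of_code_eq (f := fun n : ℕ => (n : K)) fun _ => rfl) hf

@[fun_prop]
theorem const_isSym {f : ε → Const K} (hf : PolyTime K f) : PolyTime K (fun x => (f x).isSym) := by
  have (x : ε) : (f x).isSym = (TreeCode.code (f x) : Data K).tl.truthy := by cases f x <;> rfl
  simp only [this]
  fun_prop

@[fun_prop]
theorem const_val {f : ε → Const K} (hf : PolyTime K f) : PolyTime K (fun x => (f x).val) := by
  refine of_data (d := fun x => bif (f x).isSym then (TreeCode.code (f x) : Data K).tl else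
    TreeCode.code (f x)) (by fun_prop) fun x => ?_
  cases f x <;> rfl

@[fun_prop]
theorem term_isConst {f : ε → Term K} (hf : PolyTime K f) :
    PolyTime K (fun x => (f x).isConst) := by
  have (x : ε) : (f x).isConst = (TreeCode.code (f x) : Data K).hd.truthy := by cases f x <;> rfl
  simp only [this]
  fun_prop

@[fun_prop]
theorem term_toConst {f : ε → Term K} (hf : PolyTime K f) : PolyTime K (fun x => (f x).toConst) :=
  comp (of_path (f := Term.toConst) [true] fun t => by cases t <;> rfl) hf

@[fun_prop]
theorem term_var {f : ε → ℕ} (hf : PolyTime K f) :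
    PolyTime K (fun x => (Term.var (f x) : Term K)) :=
  of_data (d := fun x => TreeCode.code (false, f x)) (by fun_prop) fun _ => rfl

@[fun_prop]
theorem atom_pred {f : ε → Atom K} (hf : PolyTime K f) : PolyTime K (fun x => (f x).pred) :=
  comp (of_path (f := Atom.pred) [false] fun _ => rfl) hf

@[fun_prop]
theorem atom_args {f : ε → Atom K} (hf : PolyTime K f) : PolyTime K (fun x => (f x).args) :=
  comp (of_path (f := Atom.args) [true] fun _ => rfl) hf

@[fun_prop]
theorem atom_mk {f : ε → ℕ} {g : ε → List (Const K)} (hf : PolyTime K f) (hg : PolyTime K g) :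
    PolyTime K (fun x => Atom.mk (f x) (g x)) :=
  of_data (d := fun x => TreeCode.code (f x, g x)) (by fun_prop) fun _ => rfl

@[fun_prop]
theorem intensional_grouped {f : ε → Intensional K} (hf : PolyTime K f) :
    PolyTime K (fun x => (f x).grouped) :=
  comp (of_path (f := Intensional.grouped) [true, false] fun _ => rfl) hf

@[fun_prop]
theorem intensional_pred {f : ε → Intensional K} (hf : PolyTime K f) :
    PolyTime K (fun x => (f x).pred) :=
  comp (of_path (f := Intensional.pred) [true, true, false] fun _ => rfl) hf

@[fun_prop]
theorem intensional_args {f : ε → Intensional K} (hf : PolyTime K f) :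
    PolyTime K (fun x => (f x).args) :=
  comp (of_path (f := Intensional.args) [true, true, true] fun _ => rfl) hf

@[fun_prop]
theorem aggAtom_fn {f : ε → AggAtom K} (hf : PolyTime K f) : PolyTime K (fun x => (f x).fn) :=
  comp (of_path (f := AggAtom.fn) [false] fun _ => rfl) hf

@[fun_prop]
theorem aggAtom_op {f : ε → AggAtom K} (hf : PolyTime K f) : PolyTime K (fun x => (f x).op) :=
  comp (of_path (f := AggAtom.op) [true, false] fun _ => rfl) hf

@[fun_prop]
theorem aggAtom_v {f : ε → AggAtom K} (hf : PolyTime K f) : PolyTime K (fun x => (f x).v) :=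
  comp (of_path (f := AggAtom.v) [true, true, false] fun _ => rfl) hf

@[fun_prop]
theorem aggAtom_s {f : ε → AggAtom K} (hf : PolyTime K f) : PolyTime K (fun x => (f x).s) :=
  comp (of_path (f := AggAtom.s) [true, true, true] fun _ => rfl) hf

@[fun_prop]
theorem rule_head {f : ε → Rule K} (hf : PolyTime K f) : PolyTime K (fun x => (f x).head) :=
  comp (of_path (f := Rule.head) [false] fun _ => rfl) hf

@[fun_prop]
theorem rule_aggs {f : ε → Rule K} (hf : PolyTime K f) : PolyTime K (fun x => (f x).aggs) :=
  comp (of_path (f := Rule.aggs) [true, false] fun _ => rfl) hf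

@[fun_prop]
theorem rule_pos {f : ε → Rule K} (hf : PolyTime K f) : PolyTime K (fun x => (f x).pos) :=
  comp (of_path (f := Rule.pos) [true, true, false] fun _ => rfl) hf

@[fun_prop]
theorem rule_neg {f : ε → Rule K} (hf : PolyTime K f) : PolyTime K (fun x => (f x).neg) :=
  comp (of_path (f := Rule.neg) [true, true, true] fun _ => rfl) hf

end PolyTime

namespace PolyTimeEq

variable [CharZero K]

instance : PolyTimeEq K ℕ :=
  of_injective (f := fun n : ℕ => (n : K)) Nat.cast_injective (by fun_prop)

instance : PolyTimeEq K (Const K) := by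
  refine of_injective (f := fun c => (c.isSym, c.val)) (fun c d h => ?_) (by fun_prop)
  cases c <;> cases d <;> simp_all [Const.isSym, Const.val]

instance : PolyTimeEq K (Term K) := by
  refine of_injective (f := fun t => (t.isConst, t.toConst)) (fun t u h => ?_) (by fun_prop)
  cases t <;> cases u <;> simp_all [Term.isConst, Term.toConst]

instance : PolyTimeEq K (Atom K) := by
  refine of_injective (f := fun a => (a.pred, a.args)) (fun a b h => ?_) (by fun_prop)
  cases a
  cases b
  simp_all

end PolyTimeEq

namespace PolyTime

variable [CharZero K]

@[fun_prop]
theorem relOp_elim {op : ε → RelOp} {f₀ f₁ f₂ f₃ f₄ f₅ : ε → β} (hop : PolyTime K op)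
    (h₀ : PolyTime K f₀) (h₁ : PolyTime K f₁) (h₂ : PolyTime K f₂) (h₃ : PolyTime K f₃)
    (h₄ : PolyTime K f₄) (h₅ : PolyTime K f₅) :
    PolyTime K (fun x => (op x).elim (f₀ x) (f₁ x) (f₂ x) (f₃ x) (f₄ x) (f₅ x)) := by
  let i (o : RelOp) : ℕ := o.elim 0 1 2 3 4 5
  have hi : PolyTime K i := of_code_eq fun o => by cases o <;> rfl
  have (x : ε) : (op x).elim (f₀ x) (f₁ x) (f₂ x) (f₃ x) (f₄ x) (f₅ x) =
      bif decide (i (op x) = 0) then f₀ x else bif decide (i (op x) = 1) then f₁ x else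
      bif decide (i (op x) = 2) then f₂ x else bif decide (i (op x) = 3) then f₃ x else
      bif decide (i (op x) = 4) then f₄ x else f₅ x := by
    cases op x <;> rfl
  simp only [this]
  clear_value i
  fun_prop

@[fun_prop]
theorem aggFn_elim {fn : ε → AggFn} {f₀ f₁ f₂ f₃ f₄ : ε → β} (hfn : PolyTime K fn)
    (h₀ : PolyTime K f₀) (h₁ : PolyTime K f₁) (h₂ : PolyTime K f₂) (h₃ : PolyTime K f₃)
    (h₄ : PolyTime K f₄) :
    PolyTime K (fun x => (fn x).elim (f₀ x) (f₁ x) (f₂ x) (f₃ x) (f₄ x)) := by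
  let i (o : AggFn) : ℕ := o.elim 0 1 2 3 4
  have hi : PolyTime K i := of_code_eq fun o => by cases o <;> rfl
  have (x : ε) : (fn x).elim (f₀ x) (f₁ x) (f₂ x) (f₃ x) (f₄ x) =
      bif decide (i (fn x) = 0) then f₀ x else bif decide (i (fn x) = 1) then f₁ x else
      bif decide (i (fn x) = 2) then f₂ x else bif decide (i (fn x) = 3) then f₃ x else f₄ x := by
    cases fn x <;> rfl
  simp only [this]
  clear_value i
  fun_prop

@[fun_prop]
theorem term_inst_unifier {t : ε → Term K} {s : ε → Intensional K} {a : ε → Atom K}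
    (ht : PolyTime K t) (hs : PolyTime K s) (ha : PolyTime K a) :
    PolyTime K (fun x => (t x).inst ((s x).unifier (a x))) := by
  have (x : ε) : (t x).inst ((s x).unifier (a x)) = bif (t x).isConst then (t x).toConst else
      (a x).args.getD ((s x).args.idxOf (t x)) (Const.sym 0) := by
    cases t x <;> rfl
  simp only [this]
  fun_prop

@[fun_prop]
theorem intensional_matches {s : ε → Intensional K} {a : ε → Atom K} (hs : PolyTime K s)
    (ha : PolyTime K a) : PolyTime K (fun x => (s x).matches (a x)) := by
  unfold Intensional.matches Intensional.inst
  fun_prop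

@[fun_prop]
theorem intensional_proj {s : ε → Intensional K} {a : ε → Atom K} (hs : PolyTime K s)
    (ha : PolyTime K a) : PolyTime K (fun x => (s x).proj (a x)) := by
  unfold Intensional.proj
  fun_prop

end PolyTime

end SyntaxCodes

/-! ### Aggregates of the groups between two lists -/

section RangeCheck

/-- Whether all elements of a set `S` with least element `lo` and greatest element `hi` are in
relation `op` to `v`, given the truth values of `v ∉ S`, `hi ≤ v`, `v ≤ lo`, `hi < v` and
`v < lo`. -/
def rangeCheck (op : RelOp) (notMem hiLe leLo hiLt ltLo : Bool) : Bool :=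
  op.elim (hiLe && leLo) notMem hiLt ltLo hiLe leLo

theorem rangeCheck_iff {V : Type} [LinearOrder V] {S : Set V} {lo hi v : V} (hlo : IsLeast S lo)
    (hhi : IsGreatest S hi) {op : RelOp} {notMem hiLe leLo hiLt ltLo : Bool}
    (hnotMem : op = .ne → (notMem ↔ v ∉ S)) (hhiLe : hiLe ↔ hi ≤ v) (hleLo : leLo ↔ v ≤ lo)
    (hhiLt : hiLt ↔ hi < v) (hltLo : ltLo ↔ v < lo) :
    rangeCheck op notMem hiLe leLo hiLt ltLo ↔ ∀ x ∈ S, op.Holds x v := by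
  cases op <;> simp only [rangeCheck, RelOp.elim, RelOp.Holds, Bool.and_eq_true]
  case eq =>
    rw [hhiLe, hleLo]
    exact ⟨fun h x hx => le_antisymm ((hhi.2 hx).trans h.1) (h.2.trans (hlo.2 hx)),
      fun h => ⟨(h hi hhi.1).le, (h lo hlo.1).ge⟩⟩
  case ne =>
    rw [hnotMem rfl]
    exact ⟨fun h x hx hxv => h (hxv ▸ hx), fun h hv => h v hv rfl⟩
  case lt => exact hhiLt.trans ⟨fun h x hx => (hhi.2 hx).trans_lt h, fun h => h hi hhi.1⟩
  case gt => exact hltLo.trans ⟨fun h x hx => h.trans_le (hlo.2 hx), fun h => h lo hlo.1⟩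
  case le => exact hhiLe.trans ⟨fun h x hx => (hhi.2 hx).trans h, fun h => h hi hhi.1⟩
  case ge => exact hleLo.trans ⟨fun h x hx => h.trans (hlo.2 hx), fun h => h lo hlo.1⟩

end RangeCheck

section Sum

theorem sum_filter_eq_sum_cond {M : Type} [AddMonoid M] (p : M → Bool) (l : List M) :
    (l.filter p).sum = (l.map fun x => bif p x then x else 0).sum := by
  induction l with
  | nil => rfl
  | cons a l ih => cases h : p a <;> simp [h, ih]

variable {K : Type} [AddCommGroup K] [LinearOrder K]

/-- Whether the sum of `D` and any part of `F` is in relation `op` to `v`, for `op` other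
than `≠`. -/
def sumCheck (op : RelOp) (v : K) (D F : List K) : Bool :=
  let hi := D.sum + (F.map fun x => bif decide (0 ≤ x) then x else 0).sum
  let lo := D.sum + (F.map fun x => bif decide (x ≤ 0) then x else 0).sum
  rangeCheck op false (decide (hi ≤ v)) (decide (v ≤ lo)) (decide (hi < v)) (decide (v < lo))

variable [IsOrderedAddMonoid K]

theorem isGreatest_sum_sublist (F : List K) :
    IsGreatest (List.sum '' {T | T.Sublist F})
      (F.map fun x => bif decide (0 ≤ x) then x else 0).sum := by
  refine ⟨⟨_, List.filter_sublist, sum_filter_eq_sum_cond _ F⟩, ?_⟩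
  rintro _ ⟨T, hT : T.Sublist F, rfl⟩
  induction hT with
  | slnil => exact le_rfl
  | cons a _ ih =>
    by_cases ha : 0 ≤ a
    · simpa [ha] using add_le_add ha ih
    · simpa [ha] using ih
  | cons_cons a _ ih =>
    by_cases ha : 0 ≤ a
    · simpa [ha] using ih
    · simpa [ha] using add_le_add (le_of_not_ge ha) ih

theorem isLeast_sum_sublist (F : List K) :
    IsLeast (List.sum '' {T | T.Sublist F})
      (F.map fun x => bif decide (x ≤ 0) then x else 0).sum := by
  refine ⟨⟨_, List.filter_sublist, sum_filter_eq_sum_cond _ F⟩, ?_⟩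
  rintro _ ⟨T, hT : T.Sublist F, rfl⟩
  induction hT with
  | slnil => exact le_rfl
  | cons a _ ih =>
    by_cases ha : a ≤ 0
    · simpa [ha] using add_le_add ha ih
    · simpa [ha] using ih
  | cons_cons a _ ih =>
    by_cases ha : a ≤ 0
    · simpa [ha] using ih
    · simpa [ha] using add_le_add (le_of_not_ge ha) ih

theorem sumCheck_iff {op : RelOp} (hop : op ≠ .ne) (v : K) (D F : List K) :
    sumCheck op v D F ↔ ∀ T, T.Sublist F → op.Holds (D ++ T).sum v := by
  have hmono : Monotone (D.sum + ·) := fun _ _ h => add_le_add_right h _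
  refine (rangeCheck_iff (hmono.map_isLeast (isLeast_sum_sublist F))
    (hmono.map_isGreatest (isGreatest_sum_sublist F)) (fun h => absurd h hop)
    decide_eq_true_iff decide_eq_true_iff decide_eq_true_iff decide_eq_true_iff).trans ?_
  simp only [Set.forall_mem_image, Set.mem_ofPred_eq, List.sum_append]

end Sum

section Count

variable {K α : Type} [Field K] [LinearOrder K]

/-- Counts from `n` upwards in steps of `1`, once for each element of `F`, but not beyond `v`. -/
def countTowards (v n : K) (F : List α) : K :=
  F.foldl (fun m _ => bif decide (m = v) then m else m + 1) n

theorem countTowards_eq_iff {v : K} [IsStrictOrderedRing K] {n : K} {F : List α} :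
    countTowards v n F = v ↔ ∃ k ≤ F.length, n + k = v := by
  induction F generalizing n with
  | nil => simp [countTowards]
  | cons a F ih =>
    by_cases hn : n = v
    · subst hn
      have hstay : countTowards n n (a :: F) = countTowards n n F := by simp [countTowards]
      rw [hstay, ih]
      exact ⟨fun _ => ⟨0, by simp⟩, fun _ => ⟨0, by simp⟩⟩
    · have hstep : countTowards v n (a :: F) = countTowards v (n + 1) F := by
        simp [countTowards, hn]
      rw [hstep, ih]
      constructor
      · rintro ⟨k, hk, rfl⟩
        exact ⟨k + 1, by simpa using hk, by push_cast; ring⟩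
      · rintro ⟨_ | k, hk, rfl⟩
        · simp at hn
        · exact ⟨k, by simpa using hk, by push_cast; ring⟩

/-- Whether the number of elements of `D` and any part of `F` is in relation `op` to `v`. -/
def countCheck (op : RelOp) (v : K) (D F : List α) : Bool :=
  let hi : K := D.length + F.length
  let lo : K := D.length
  rangeCheck op (!decide (countTowards v lo F = v)) (decide (hi ≤ v)) (decide (v ≤ lo))
    (decide (hi < v)) (decide (v < lo))

theorem countCheck_iff [IsStrictOrderedRing K] (op : RelOp) (v : K) (D F : List α) :
    countCheck op v D F ↔ ∀ T, T.Sublist F → op.Holds ((D ++ T).length : K) v := by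
  let S : Set K := (fun T : List α => (D.length : K) + T.length) '' {T | T.Sublist F}
  have hlo : IsLeast S D.length := by
    refine ⟨⟨[], List.nil_sublist F, by simp⟩, ?_⟩
    rintro _ ⟨T, -, rfl⟩
    simp
  have hhi : IsGreatest S (D.length + F.length) := by
    refine ⟨⟨F, List.Sublist.refl F, rfl⟩, ?_⟩
    rintro _ ⟨T, hT, rfl⟩
    simpa using hT.length_le
  have hnotMem : (!decide (countTowards v (D.length : K) F = v)) ↔ v ∉ S := by
    rw [Bool.not_eq_true', decide_eq_false_iff_not, countTowards_eq_iff, not_iff_not]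
    constructor
    · rintro ⟨k, hk, rfl⟩
      exact ⟨F.take k, F.take_sublist k, by simp [hk]⟩
    · rintro ⟨T, hT, rfl⟩
      exact ⟨T.length, hT.length_le, rfl⟩
  refine (rangeCheck_iff hlo hhi (fun _ => hnotMem) decide_eq_true_iff decide_eq_true_iff
    decide_eq_true_iff decide_eq_true_iff).trans ?_
  simp [S]

end Count

section MinMax

variable {K : Type} [LinearOrder K]

/-- The embedding of the numbers into their extension by `±∞`. -/
def extended (x : K) : WithBot (WithTop K) := ((x : WithTop K) : WithBot (WithTop K))

theorem extended_le_extended {x y : K} : extended x ≤ extended y ↔ x ≤ y := by simp [extended]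

theorem extended_lt_extended {x y : K} : extended x < extended y ↔ x < y := by simp [extended]

theorem RelOp.holds_extended {op : RelOp} {x v : K} :
    op.Holds (extended x) (extended v) ↔ op.Holds x v := by
  cases op <;> simp [RelOp.Holds, extended]

/-- The minimum of a list in the extended numbers. -/
def extendedMin (l : List K) : WithBot (WithTop K) := ((l : Multiset K).map extended).inf

/-- The maximum of a list in the extended numbers. -/
def extendedMax (l : List K) : WithBot (WithTop K) := ((l : Multiset K).map extended).sup

theorem le_extendedMin_iff {w : WithBot (WithTop K)} {l : List K} :
    w ≤ extendedMin l ↔ ∀ x ∈ l, w ≤ extended x := by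
  rw [extendedMin, Multiset.le_inf]
  simp only [Multiset.mem_map, Multiset.mem_coe, forall_exists_index, and_imp,
    forall_apply_eq_imp_iff₂]

theorem extendedMax_le_iff {w : WithBot (WithTop K)} {l : List K} :
    extendedMax l ≤ w ↔ ∀ x ∈ l, extended x ≤ w := by
  rw [extendedMax, Multiset.sup_le]
  simp only [Multiset.mem_map, Multiset.mem_coe, forall_exists_index, and_imp,
    forall_apply_eq_imp_iff₂]

theorem lt_extendedMin_iff {v : K} {l : List K} :
    extended v < extendedMin l ↔ ∀ x ∈ l, v < x := by
  induction l with
  | nil => simpa [extendedMin, extended] using WithBot.coe_lt_coe.2 (WithTop.coe_lt_top v)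
  | cons a l ih =>
    have hcons : extendedMin (a :: l) = extended a ⊓ extendedMin l := by simp [extendedMin]
    rw [hcons, lt_inf_iff, ih, extended_lt_extended, List.forall_mem_cons]

theorem extendedMax_lt_iff {v : K} {l : List K} :
    extendedMax l < extended v ↔ ∀ x ∈ l, x < v := by
  induction l with
  | nil => simp [extendedMax, extended]
  | cons a l ih =>
    have hcons : extendedMax (a :: l) = extended a ⊔ extendedMax l := by simp [extendedMax]
    rw [hcons, sup_lt_iff, ih, extended_lt_extended, List.forall_mem_cons]

theorem extendedMin_eq_iff {v : K} {l : List K} :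
    extendedMin l = extended v ↔ (∀ x ∈ l, v ≤ x) ∧ v ∈ l := by
  rw [le_antisymm_iff, and_comm, le_extendedMin_iff, ← not_lt, lt_extendedMin_iff]
  simp only [extended_le_extended]
  refine and_congr_right fun h => ?_
  push Not
  exact ⟨fun ⟨x, hx, hxv⟩ => le_antisymm (h x hx) hxv ▸ hx, fun hv => ⟨v, hv, le_rfl⟩⟩

theorem extendedMax_eq_iff {v : K} {l : List K} :
    extendedMax l = extended v ↔ (∀ x ∈ l, x ≤ v) ∧ v ∈ l := by
  rw [le_antisymm_iff, ← not_lt (b := extended v), extendedMax_le_iff, extendedMax_lt_iff]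
  simp only [extended_le_extended]
  refine and_congr_right fun h => ?_
  push Not
  exact ⟨fun ⟨x, hx, hxv⟩ => le_antisymm (h x hx) hxv ▸ hx, fun hv => ⟨v, hv, le_rfl⟩⟩

/-- Whether the minimum of `D` and any part of `F` is in relation `op` to `v`. -/
def minCheck (op : RelOp) (v : K) (D F : List K) : Bool :=
  rangeCheck op (!(D.all (fun x => decide (v ≤ x)) && decide (v ∈ D ++ F)))
    (D.any fun x => decide (x ≤ v)) ((D ++ F).all fun x => decide (v ≤ x))
    (D.any fun x => decide (x < v)) ((D ++ F).all fun x => decide (v < x))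

/-- Whether the maximum of `D` and any part of `F` is in relation `op` to `v`. -/
def maxCheck (op : RelOp) (v : K) (D F : List K) : Bool :=
  rangeCheck op (!(D.all (fun x => decide (x ≤ v)) && decide (v ∈ D ++ F)))
    ((D ++ F).all fun x => decide (x ≤ v)) (D.any fun x => decide (v ≤ x))
    ((D ++ F).all fun x => decide (x < v)) (D.any fun x => decide (v < x))

theorem exists_sublist_extendedMin_eq_iff {v : K} {D F : List K} :
    (∃ T, T.Sublist F ∧ extendedMin (D ++ T) = extended v) ↔
      (∀ x ∈ D, v ≤ x) ∧ v ∈ D ++ F := by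
  simp only [extendedMin_eq_iff]
  constructor
  · rintro ⟨T, hT, hle, hmem⟩
    exact ⟨fun x hx => hle x (List.mem_append_left T hx), hT.append_left D |>.subset hmem⟩
  · rintro ⟨hle, hmem⟩
    refine ⟨F.filter fun x => decide (v ≤ x), List.filter_sublist, fun x hx => ?_, ?_⟩
    · exact (List.mem_append.1 hx).elim (hle x) fun hx => by simpa using (List.mem_filter.1 hx).2
    · simpa using hmem

theorem exists_sublist_extendedMax_eq_iff {v : K} {D F : List K} :
    (∃ T, T.Sublist F ∧ extendedMax (D ++ T) = extended v) ↔
      (∀ x ∈ D, x ≤ v) ∧ v ∈ D ++ F := by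
  simp only [extendedMax_eq_iff]
  constructor
  · rintro ⟨T, hT, hle, hmem⟩
    exact ⟨fun x hx => hle x (List.mem_append_left T hx), hT.append_left D |>.subset hmem⟩
  · rintro ⟨hle, hmem⟩
    refine ⟨F.filter fun x => decide (x ≤ v), List.filter_sublist, fun x hx => ?_, ?_⟩
    · exact (List.mem_append.1 hx).elim (hle x) fun hx => by simpa using (List.mem_filter.1 hx).2
    · simpa using hmem

theorem minCheck_iff (op : RelOp) (v : K) (D F : List K) :
    minCheck op v D F ↔
      ∀ T, T.Sublist F → op.Holds (extendedMin (D ++ T)) (extended v) := by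
  let S := (fun T => extendedMin (D ++ T)) '' {T | T.Sublist F}
  have hanti {l l' : List K} (h : l ⊆ l') : extendedMin l' ≤ extendedMin l :=
    le_extendedMin_iff.2 fun x hx => le_extendedMin_iff.1 le_rfl x (h hx)
  have hlo : IsLeast S (extendedMin (D ++ F)) := by
    refine ⟨⟨F, List.Sublist.refl F, rfl⟩, ?_⟩
    rintro _ ⟨T, hT : T.Sublist F, rfl⟩
    exact hanti (hT.append_left D).subset
  have hhi : IsGreatest S (extendedMin D) := by
    refine ⟨⟨[], List.nil_sublist F, by simp⟩, ?_⟩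
    rintro _ ⟨T, -, rfl⟩
    exact hanti (D.subset_append_left T)
  have hmem : extended v ∈ S ↔ (∀ x ∈ D, v ≤ x) ∧ v ∈ D ++ F :=
    exists_sublist_extendedMin_eq_iff
  refine (rangeCheck_iff (v := extended v) hlo hhi (fun _ => ?_) ?_ ?_ ?_ ?_).trans
    Set.forall_mem_image
  · rw [hmem, Bool.not_eq_true', ← Bool.not_eq_true, Bool.and_eq_true]
    simp only [List.all_eq_true, decide_eq_true_eq]
  · rw [← not_lt, lt_extendedMin_iff]
    simp
  · rw [le_extendedMin_iff]
    simp only [List.all_eq_true, decide_eq_true_eq, extended_le_extended]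
  · rw [← not_le, le_extendedMin_iff]
    simp [extended_le_extended]
  · rw [lt_extendedMin_iff]
    simp only [List.all_eq_true, decide_eq_true_eq]

theorem maxCheck_iff (op : RelOp) (v : K) (D F : List K) :
    maxCheck op v D F ↔
      ∀ T, T.Sublist F → op.Holds (extendedMax (D ++ T)) (extended v) := by
  let S := (fun T => extendedMax (D ++ T)) '' {T | T.Sublist F}
  have hmono {l l' : List K} (h : l ⊆ l') : extendedMax l ≤ extendedMax l' :=
    extendedMax_le_iff.2 fun x hx => extendedMax_le_iff.1 le_rfl x (h hx)
  have hlo : IsLeast S (extendedMax D) := by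
    refine ⟨⟨[], List.nil_sublist F, by simp⟩, ?_⟩
    rintro _ ⟨T, -, rfl⟩
    exact hmono (D.subset_append_left T)
  have hhi : IsGreatest S (extendedMax (D ++ F)) := by
    refine ⟨⟨F, List.Sublist.refl F, rfl⟩, ?_⟩
    rintro _ ⟨T, hT : T.Sublist F, rfl⟩
    exact hmono (hT.append_left D).subset
  have hmem : extended v ∈ S ↔ (∀ x ∈ D, x ≤ v) ∧ v ∈ D ++ F :=
    exists_sublist_extendedMax_eq_iff
  refine (rangeCheck_iff (v := extended v) hlo hhi (fun _ => ?_) ?_ ?_ ?_ ?_).trans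
    Set.forall_mem_image
  · rw [hmem, Bool.not_eq_true', ← Bool.not_eq_true, Bool.and_eq_true]
    simp only [List.all_eq_true, decide_eq_true_eq]
  · rw [extendedMax_le_iff]
    simp only [List.all_eq_true, decide_eq_true_eq, extended_le_extended]
  · rw [← not_lt, extendedMax_lt_iff]
    simp
  · rw [extendedMax_lt_iff]
    simp only [List.all_eq_true, decide_eq_true_eq]
  · rw [← not_le, extendedMax_le_iff]
    simp [extended_le_extended]

end MinMax

section Average

variable {K : Type} [Field K] [LinearOrder K]

/-- Whether the average of `D` and any part of `F` is defined and in relation `op` to `v`, for `op`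
other than `≠`. -/
def avgCheck (op : RelOp) (v : K) (D F : List K) : Bool :=
  !D.isEmpty && sumCheck op 0 (D.map fun x => x - v) (F.map fun x => x - v)

variable [IsStrictOrderedRing K]

theorem RelOp.holds_div_iff (op : RelOp) (a v : K) {c : K} (hc : 0 < c) :
    op.Holds (a / c) v ↔ op.Holds (a - c * v) 0 := by
  cases op <;> simp only [RelOp.Holds]
  case eq => rw [div_eq_iff hc.ne', sub_eq_zero, mul_comm]
  case ne => rw [ne_eq, ne_eq, div_eq_iff hc.ne', sub_eq_zero, mul_comm]
  case lt => rw [div_lt_iff₀ hc, sub_neg, mul_comm]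
  case gt => rw [lt_div_iff₀ hc, sub_pos, mul_comm]
  case le => rw [div_le_iff₀ hc, sub_nonpos, mul_comm]
  case ge => rw [le_div_iff₀ hc, sub_nonneg, mul_comm]

theorem RelOp.holds_average_iff (op : RelOp) (v : K) {l : List K} (hl : l ≠ []) :
    op.Holds (l.sum / l.length) v ↔ op.Holds (l.map fun x => x - v).sum 0 := by
  have hsum : (l.map fun x => x - v).sum = l.sum - l.length * v := by
    simpa using Multiset.sum_map_sub (m := (l : Multiset K)) (f := fun x => x) (g := fun _ => v)
  rw [hsum, op.holds_div_iff _ _ (by simpa [List.length_pos_iff] using hl)]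

theorem avgCheck_iff {op : RelOp} (hop : op ≠ .ne) (v : K) (D F : List K) :
    avgCheck op v D F ↔ ∀ T, T.Sublist F →
      D ++ T ≠ [] ∧ op.Holds ((D ++ T).sum / (D ++ T).length) v := by
  rcases eq_or_ne D [] with rfl | hD
  · simpa [avgCheck] using ⟨[], List.nil_sublist F, fun h => absurd rfl h⟩
  · have hne (T : List K) : D ++ T ≠ [] := List.append_ne_nil_of_left_ne_nil hD T
    have hsum (T : List K) : op.Holds ((D ++ T).sum / (D ++ T).length) v ↔
        op.Holds (D.map (fun x => x - v) ++ T.map fun x => x - v).sum 0 := by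
      rw [op.holds_average_iff v (hne T), List.map_append]
    have hcheck : avgCheck op v D F ↔
        sumCheck op 0 (D.map fun x => x - v) (F.map fun x => x - v) := by simp [avgCheck, hD]
    rw [hcheck, sumCheck_iff hop]
    refine ⟨fun h T hT => ⟨hne T, (hsum T).2 (h _ (hT.map _))⟩, fun h T hT => ?_⟩
    obtain ⟨T', hT', rfl⟩ := List.sublist_map_iff.1 hT
    exact (hsum T').1 (h T' hT').2

end Average

section Groups

/-- Whether all members of a group are numbers. -/
def numeric {K : Type} (l : List (Const K)) : Bool := l.all fun c => !c.isSym

theorem numeric_append {K : Type} (l l' : List (Const K)) :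
    numeric (l ++ l') = (numeric l && numeric l') := List.all_append

variable {K : Type} [Field K]

/-- The numbers in a group. -/
def vals (l : List (Const K)) : List K := l.map Const.val

theorem map_num_vals {l : List (Const K)} (h : numeric l) : (vals l).map Const.num = l := by
  rw [vals, List.map_map]
  refine (List.map_congr_left fun c hc => ?_).trans l.map_id
  have := List.all_eq_true.1 h c hc
  cases c <;> simp_all [Const.isSym, Const.val]

variable [LinearOrder K]

namespace AggFn

/-- The aggregate of `l` is defined and in relation `op` to `v`. -/
def Satisfies (fn : AggFn) (op : RelOp) (v : K) (l : List (Const K)) : Prop :=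
  ∃ y, fn.eval (l : Multiset (Const K)) = some y ∧ op.Holds y (extended v)

/-- Whether `fn` of `D` and any part of `F` is defined and in relation `op` to `v`, for `op` other
than `≠` if `fn` is `Sum` or `Avg`. -/
def groupCheck (fn : AggFn) (op : RelOp) (v : K) (D F : List (Const K)) : Bool :=
  fn.elim
    (numeric (D ++ F) && sumCheck op v (vals D) (vals F))
    (countCheck op v D F)
    (numeric (D ++ F) && minCheck op v (vals D) (vals F))
    (numeric (D ++ F) && maxCheck op v (vals D) (vals F))
    (numeric (D ++ F) && avgCheck op v (vals D) (vals F))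

variable {fn : AggFn} {op : RelOp} {v : K}

theorem numeric_of_satisfies (hfn : fn ≠ .count) {l : List (Const K)}
    (h : fn.Satisfies op v l) : numeric l := by
  obtain ⟨y, hy, -⟩ := h
  have hnum : ∀ c ∈ l, c.num? ≠ none := by
    cases fn <;> simp_all [eval]
  refine List.all_eq_true.2 fun c hc => ?_
  have := hnum c hc
  cases c <;> simp_all [Const.isSym, Const.num?]

theorem satisfies_sum_iff {xs : List K} :
    sum.Satisfies op v (xs.map Const.num) ↔ op.Holds xs.sum v := by
  have heval : sum.eval (xs.map Const.num : Multiset (Const K)) = some (extended xs.sum) := by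
    simp [eval, List.filterMap_map, Function.comp_def, Const.num?, extended]
  simp only [Satisfies, heval, Option.some.injEq, exists_eq_left', RelOp.holds_extended]

theorem satisfies_count_iff {l : List (Const K)} :
    count.Satisfies op v l ↔ op.Holds (l.length : K) v := by
  simp only [Satisfies, eval, Multiset.coe_card, Option.some.injEq, exists_eq_left']
  exact RelOp.holds_extended

theorem satisfies_min_iff {xs : List K} :
    min.Satisfies op v (xs.map Const.num) ↔ op.Holds (extendedMin xs) (extended v) := by
  have heval : min.eval (xs.map Const.num : Multiset (Const K)) = some (extendedMin xs) := by
    simp [eval, List.filterMap_map, Function.comp_def, Const.num?, extendedMin]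
    rfl
  simp only [Satisfies, heval, Option.some.injEq, exists_eq_left']

theorem satisfies_max_iff {xs : List K} :
    max.Satisfies op v (xs.map Const.num) ↔ op.Holds (extendedMax xs) (extended v) := by
  have heval : max.eval (xs.map Const.num : Multiset (Const K)) = some (extendedMax xs) := by
    simp [eval, List.filterMap_map, Function.comp_def, Const.num?, extendedMax]
    rfl
  simp only [Satisfies, heval, Option.some.injEq, exists_eq_left']

theorem satisfies_avg_iff {xs : List K} :
    avg.Satisfies op v (xs.map Const.num) ↔ xs ≠ [] ∧ op.Holds (xs.sum / xs.length) v := by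
  rcases eq_or_ne xs [] with rfl | hxs
  · simp [Satisfies, eval]
  · have heval : avg.eval (xs.map Const.num : Multiset (Const K)) =
        some (extended (xs.sum / xs.length)) := by
      simp [eval, List.filterMap_map, Function.comp_def, Const.num?, hxs, extended]
    simp [Satisfies, heval, hxs, RelOp.holds_extended]

theorem forall_satisfies_iff (hfn : fn ≠ .count) (D F : List (Const K)) :
    (∀ T, T.Sublist F → fn.Satisfies op v (D ++ T)) ↔ numeric (D ++ F) ∧
      ∀ T, T.Sublist (vals F) → fn.Satisfies op v ((vals D ++ T).map Const.num) := by
  have hnum (xs : List K) (hDF : numeric (D ++ F)) :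
      (vals D ++ xs).map Const.num = D ++ xs.map Const.num := by
    rw [numeric_append, Bool.and_eq_true] at hDF
    rw [List.map_append, map_num_vals hDF.1]
  have hF (hDF : numeric (D ++ F)) : (vals F).map Const.num = F := by
    rw [numeric_append, Bool.and_eq_true] at hDF
    exact map_num_vals hDF.2
  constructor
  · intro h
    have hDF : numeric (D ++ F) := numeric_of_satisfies hfn (h F (List.Sublist.refl F))
    refine ⟨hDF, fun T hT => ?_⟩
    rw [hnum T hDF]
    exact h _ (hF hDF ▸ hT.map Const.num)
  · rintro ⟨hDF, h⟩ T hT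
    rw [← hF hDF] at hT
    obtain ⟨xs, hxs, rfl⟩ := List.sublist_map_iff.1 hT
    exact hnum xs hDF ▸ h xs hxs

variable [IsStrictOrderedRing K]

theorem groupCheck_iff (h : (fn ≠ .sum ∧ fn ≠ .avg) ∨ op ≠ .ne) (D F : List (Const K)) :
    fn.groupCheck op v D F ↔ ∀ T, T.Sublist F → fn.Satisfies op v (D ++ T) := by
  cases fn <;> simp only [groupCheck, AggFn.elim]
  case count => simp only [satisfies_count_iff, countCheck_iff]
  all_goals
    rw [forall_satisfies_iff (by decide), Bool.and_eq_true]
    refine and_congr_right fun _ => ?_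
  case sum => simp only [satisfies_sum_iff, sumCheck_iff (by simpa using h)]
  case min => simp only [satisfies_min_iff, minCheck_iff]
  case max => simp only [satisfies_max_iff, maxCheck_iff]
  case avg => simp only [satisfies_avg_iff, avgCheck_iff (by simpa using h)]

end AggFn

end Groups

section RunningTime

variable {K : Type} [Field K] [LinearOrder K] [CostModel K]
  {α ε : Type} [TreeCode K α] [TreeCode K ε]

namespace PolyTime

@[fun_prop]
theorem countTowards {v n : ε → K} {F : ε → List α} (hv : PolyTime K v) (hn : PolyTime K n)
    (hF : PolyTime K F) : PolyTime K (fun x => countTowards (v x) (n x) (F x)) := by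
  refine list_foldl_of_growth (step := fun x (m : K) _ => bif decide (m = v x) then m else m + 1)
    hF hn (by fun_prop) (.C (CostModel.mag (1 : K))) fun x m a _ => ?_
  have := CostModel.mag_add m 1
  rw [code_num, code_num, Polynomial.eval_C]
  cases decide (m = v x) <;> simp only [cond_true, cond_false, Data.vol] <;> omega

@[fun_prop]
theorem numeric {l : ε → List (Const K)} (hl : PolyTime K l) :
    PolyTime K (fun x => numeric (l x)) := by
  unfold AggSol.numeric
  fun_prop

@[fun_prop]
theorem vals {l : ε → List (Const K)} (hl : PolyTime K l) : PolyTime K (fun x => vals (l x)) := by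
  unfold AggSol.vals
  fun_prop

variable [CharZero K]

@[fun_prop]
theorem rangeCheck {op : ε → RelOp} {f₁ f₂ f₃ f₄ f₅ : ε → Bool} (hop : PolyTime K op)
    (h₁ : PolyTime K f₁) (h₂ : PolyTime K f₂) (h₃ : PolyTime K f₃) (h₄ : PolyTime K f₄)
    (h₅ : PolyTime K f₅) :
    PolyTime K (fun x => rangeCheck (op x) (f₁ x) (f₂ x) (f₃ x) (f₄ x) (f₅ x)) := by
  unfold AggSol.rangeCheck
  fun_prop

@[fun_prop]
theorem sumCheck {op : ε → RelOp} {v : ε → K} {D F : ε → List K} (hop : PolyTime K op)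
    (hv : PolyTime K v) (hD : PolyTime K D) (hF : PolyTime K F) :
    PolyTime K (fun x => sumCheck (op x) (v x) (D x) (F x)) := by
  unfold AggSol.sumCheck
  fun_prop

@[fun_prop]
theorem countCheck {op : ε → RelOp} {v : ε → K} {D F : ε → List α} (hop : PolyTime K op)
    (hv : PolyTime K v) (hD : PolyTime K D) (hF : PolyTime K F) :
    PolyTime K (fun x => countCheck (op x) (v x) (D x) (F x)) := by
  unfold AggSol.countCheck
  fun_prop

@[fun_prop]
theorem minCheck {op : ε → RelOp} {v : ε → K} {D F : ε → List K} (hop : PolyTime K op)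
    (hv : PolyTime K v) (hD : PolyTime K D) (hF : PolyTime K F) :
    PolyTime K (fun x => minCheck (op x) (v x) (D x) (F x)) := by
  unfold AggSol.minCheck
  fun_prop

@[fun_prop]
theorem maxCheck {op : ε → RelOp} {v : ε → K} {D F : ε → List K} (hop : PolyTime K op)
    (hv : PolyTime K v) (hD : PolyTime K D) (hF : PolyTime K F) :
    PolyTime K (fun x => maxCheck (op x) (v x) (D x) (F x)) := by
  unfold AggSol.maxCheck
  fun_prop

@[fun_prop]
theorem avgCheck {op : ε → RelOp} {v : ε → K} {D F : ε → List K} (hop : PolyTime K op)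
    (hv : PolyTime K v) (hD : PolyTime K D) (hF : PolyTime K F) :
    PolyTime K (fun x => avgCheck (op x) (v x) (D x) (F x)) := by
  unfold AggSol.avgCheck
  fun_prop

@[fun_prop]
theorem groupCheck {fn : ε → AggFn} {op : ε → RelOp} {v : ε → K} {D F : ε → List (Const K)}
    (hfn : PolyTime K fn) (hop : PolyTime K op) (hv : PolyTime K v) (hD : PolyTime K D)
    (hF : PolyTime K F) : PolyTime K (fun x => (fn x).groupCheck (op x) (v x) (D x) (F x)) := by
  unfold AggFn.groupCheck
  fun_prop

end PolyTime

end RunningTime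

/-! ### Aggregate solutions -/

section Solutions

variable {K : Type}

section Listing

variable [DecidableEq K]

namespace Intensional

/-- The values of the grouped variable in the instances of the grouped atom that occur in a list. -/
def values (s : Intensional K) (L : List (Atom K)) : List (Const K) :=
  (L.filter s.matches).map s.proj

theorem values_append (s : Intensional K) (L L' : List (Atom K)) :
    s.values (L ++ L') = s.values L ++ s.values L' := by
  rw [values, List.filter_append, List.map_append, values, values]

theorem mem_support {s : Intensional K} {M : Finset (Atom K)} {a : Atom K} :
    a ∈ s.support M ↔ a ∈ M ∧ s.matches a := by
  classical rw [support, Finset.mem_filter, matches_iff]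

theorem interp_eq_map_support (s : Intensional K) (M : Finset (Atom K)) :
    s.interp M = (s.support M).val.map s.proj := by
  rw [interp]
  rcases hkind : s.kind with _ | _
  · refine Finset.image_val_of_injOn fun a ha b hb hab => ?_
    obtain ⟨γ, rfl⟩ := matches_iff.1 (mem_support.1 ha).2
    obtain ⟨δ, rfl⟩ := matches_iff.1 (mem_support.1 hb).2
    rw [proj_inst, proj_inst] at hab
    refine congrArg (Atom.mk s.pred) (List.map_congr_left fun t ht => ?_)
    cases t with
    | const c => rfl
    | var i => rwa [s.set_no_local hkind i ht]
  · rfl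

theorem interp_toFinset (s : Intensional K) {L : List (Atom K)} (hL : L.Nodup) :
    s.interp L.toFinset = (s.values L : Multiset (Const K)) := by
  have hsupport : s.support L.toFinset = (L.filter s.matches).toFinset := by
    ext a
    simp [mem_support]
  rw [interp_eq_map_support, hsupport, List.toFinset_val, (hL.filter _).dedup, Multiset.map_coe,
    values]

theorem forall_sublist_values {s : Intensional K} {L : List (Atom K)}
    {p : List (Const K) → Prop} :
    (∀ T, T.Sublist (s.values L) → p T) ↔ ∀ T, T.Sublist L → p (s.values T) := by
  refine ⟨fun h T hT => h _ ((hT.filter _).map _), fun h T' hT' => ?_⟩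
  obtain ⟨T, hT, rfl⟩ := List.sublist_map_iff.1 hT'
  have hmatch : T.filter s.matches = T :=
    List.filter_eq_self.2 fun a ha => (List.mem_filter.1 (hT.subset ha)).2
  simpa only [values, hmatch] using h T (hT.trans List.filter_sublist)

end Intensional

theorem AggAtom.interp_inter_ext (l : AggAtom K) {B M : Finset (Atom K)} (hM : M ⊆ B) :
    l.s.interp (M ∩ l.ext B) = l.s.interp M := by
  rw [Intensional.interp_eq_map_support, Intensional.interp_eq_map_support]
  congr 2
  ext a
  rw [Intensional.mem_support, Intensional.mem_support, Finset.mem_inter, ext, Finset.mem_filter]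
  refine ⟨fun h => ⟨h.1.1, h.2⟩, fun h => ⟨⟨h.1, hM h.1, ?_⟩, h.2⟩⟩
  obtain ⟨γ, rfl⟩ := Intensional.matches_iff.1 h.2
  simp [Intensional.inst]

/-- The atoms of `H` whose truth value is left open by `⟨I, J⟩`. -/
def undecided (H I J : List (Atom K)) : List (Atom K) :=
  H.filter fun a => !decide (a ∈ I) && !decide (a ∈ J)

theorem mem_undecided {H I J : List (Atom K)} {a : Atom K} :
    a ∈ undecided H I J ↔ a ∈ H ∧ a ∉ I ∧ a ∉ J := by
  simp [undecided]

end Listing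

variable [Field K] [LinearOrder K]

/-- Whether `⟨I, J⟩` is an aggregate solution of `l`, where `H` lists `H(l)`. -/
def AggAtom.solutionCheck (l : AggAtom K) (H I J : List (Atom K)) : Bool :=
  l.fn.groupCheck l.op l.v (l.s.values I) (l.s.values (undecided H I J))

theorem AggAtom.sat_toFinset_iff (l : AggAtom K) {L : List (Atom K)} (hL : L.Nodup) :
    l.Sat L.toFinset ↔ l.fn.Satisfies l.op l.v (l.s.values L) := by
  rw [Sat, l.s.interp_toFinset hL]
  rfl

namespace SolutionInstance

variable (x : SolutionInstance K)

theorem mem_H_iff {a : Atom K} : a ∈ x.H ↔ a ∈ x.l.ext x.B := by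
  rw [← x.H_eq, List.mem_toFinset]

theorem nodup_append_of_sublist_undecided {T : List (Atom K)}
    (hT : T.Sublist (undecided x.H x.I x.J)) : (x.I ++ T).Nodup :=
  x.I_nodup.append (hT.nodup (x.H_nodup.filter _)) fun _ haI haT =>
    (mem_undecided.1 (hT.subset haT)).2.1 haI

theorem yes_iff_forall_sublist_undecided :
    x.Yes ↔ ∀ T, T.Sublist (undecided x.H x.I x.J) → x.l.Sat (x.I ++ T).toFinset := by
  have hsub {L : List (Atom K)} (hL : L ⊆ x.H) : L.toFinset ⊆ x.l.ext x.B := by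
    rw [← x.H_eq]
    exact fun a ha => List.mem_toFinset.2 (hL (List.mem_toFinset.1 ha))
  constructor
  · rintro ⟨-, -, -, h⟩ T hT
    have hU {a : Atom K} (ha : a ∈ T) : a ∈ x.H ∧ a ∉ x.I ∧ a ∉ x.J :=
      mem_undecided.1 (hT.subset ha)
    refine h _ ((hsub ?_).trans (Finset.filter_subset _ _)) ?_ ?_
    · exact List.append_subset.2 ⟨x.I_sub, fun a ha => (hU ha).1⟩
    · simp only [List.toFinset_append, Finset.subset_union_left]
    · rw [← Finset.disjoint_iff_inter_eq_empty, List.disjoint_toFinset_iff_disjoint,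
        List.disjoint_append_right]
      exact ⟨x.disj.symm, fun a haJ haT => (hU haT).2.2 haJ⟩
  · intro h
    refine ⟨hsub x.I_sub, hsub x.J_sub, List.disjoint_toFinset_iff_disjoint.2 x.disj,
      fun M hM hIM hJM => ?_⟩
    have hrestrict : (x.I ++ (undecided x.H x.I x.J).filter (· ∈ M)).toFinset =
        M ∩ x.l.ext x.B := by
      ext a
      have hI : a ∈ x.I → a ∈ M ∧ a ∈ x.H := fun ha => ⟨hIM (List.mem_toFinset.2 ha), x.I_sub ha⟩
      have hJ : a ∈ M → a ∉ x.J := fun haM haJ =>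
        Finset.eq_empty_iff_forall_notMem.1 hJM a (by simp [haM, haJ])
      simp only [List.mem_toFinset, List.mem_append, List.mem_filter, mem_undecided,
        decide_eq_true_eq, Finset.mem_inter, ← x.mem_H_iff]
      tauto
    have := h _ (List.filter_sublist (p := (· ∈ M)))
    rwa [hrestrict, AggAtom.Sat, x.l.interp_inter_ext hM] at this

theorem yes_iff [IsStrictOrderedRing K] (hx : x.l.Tractable) :
    x.Yes ↔ x.l.solutionCheck x.H x.I x.J := by
  rw [AggAtom.solutionCheck, AggFn.groupCheck_iff hx, Intensional.forall_sublist_values,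
    yes_iff_forall_sublist_undecided]
  refine forall₂_congr fun T hT => ?_
  rw [x.l.sat_toFinset_iff (x.nodup_append_of_sublist_undecided hT), Intensional.values_append]

end SolutionInstance

end Solutions

/-! ### Answer sets -/

section Fixpoints

variable {α : Type} {f : Finset α → Finset α} {B : Finset α}

theorem iterate_empty_subset (hB : ∀ I, f I ⊆ B) (n : ℕ) : f^[n] ∅ ⊆ B := by
  cases n with
  | zero => exact Finset.empty_subset B
  | succ n =>
    rw [Function.iterate_succ_apply']
    exact hB _

theorem map_iterate_empty_eq (hf : Monotone f) (hB : ∀ I, f I ⊆ B) {n : ℕ} (hn : B.card ≤ n) :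
    f (f^[n] ∅) = f^[n] ∅ := by
  have hmono : Monotone fun m => f^[m] ∅ :=
    hf.monotone_iterate_of_le_map (Finset.empty_subset _)
  have hcard {m m' : ℕ} (hm : m ≤ m') (h : (f^[m] ∅).card = (f^[m'] ∅).card) :
      f^[m] ∅ = f^[m'] ∅ := Finset.eq_of_subset_of_card_le (hmono hm) h.ge
  have hstable {m : ℕ} (hm : B.card ≤ m) : (f^[m] ∅).card = (f^[B.card] ∅).card :=
    Nat.stabilises_of_monotone (f := fun m => (f^[m] ∅).card)
      (fun _ _ h => Finset.card_le_card (hmono h))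
      (fun m => Finset.card_le_card (iterate_empty_subset hB m))
      (fun m h => by
        simpa only [Function.iterate_succ_apply'] using
          congrArg (fun I => (f I).card) (hcard m.le_succ h)) hm
  rw [← Function.iterate_succ_apply' f]
  exact (hcard n.le_succ ((hstable hn).trans (hstable (hn.trans n.le_succ)).symm)).symm

theorem isLeast_fixpoint_iff_iterate_empty_eq (hf : Monotone f) (hB : ∀ I, f I ⊆ B) {n : ℕ}
    (hn : B.card ≤ n) {M : Finset α} : IsLeast {I | I ⊆ B ∧ f I = I} M ↔ f^[n] ∅ = M := by
  have hleast : IsLeast {I | I ⊆ B ∧ f I = I} (f^[n] ∅) := by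
    refine ⟨⟨iterate_empty_subset hB n, map_iterate_empty_eq hf hB hn⟩, fun I hI => ?_⟩
    exact (hf.iterate n (Finset.empty_subset I)).trans_eq (Function.iterate_fixed hI.2 n)
  exact ⟨hleast.unique, fun h => h ▸ hleast⟩

end Fixpoints

section AnswerSets

variable {K : Type}

section Listing

variable [DecidableEq K]

/-- A listing of `H(l)`, given a listing of the Herbrand base. -/
def AggAtom.extList (l : AggAtom K) (B : List (Atom K)) : List (Atom K) :=
  B.filter fun a => decide (a.pred = l.s.pred) && decide (a.args.length = l.s.args.length)

theorem AggAtom.toFinset_extList (l : AggAtom K) (B : List (Atom K)) :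
    (l.extList B).toFinset = l.ext B.toFinset := by
  ext a
  simp [extList, ext]

end Listing

variable [Field K] [LinearOrder K]

theorem AggAtom.CondSat.mono {l : AggAtom K} {B I I' M : Finset (Atom K)} (h : I ⊆ I')
    (hl : l.CondSat B I M) : l.CondSat B I' M := by
  obtain ⟨-, hJ, -, hsat⟩ := hl
  have hsub : I ∩ M ∩ l.ext B ⊆ I' ∩ M ∩ l.ext B := by gcongr
  have hdisj : Disjoint (I' ∩ M ∩ l.ext B) (l.ext B \ M) :=
    Finset.disjoint_sdiff.mono_left (Finset.inter_subset_left.trans Finset.inter_subset_right)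
  exact ⟨Finset.inter_subset_right, hJ, hdisj, fun N hN hI => hsat N hN (hsub.trans hI)⟩

theorem mem_consequence {B M I : Finset (Atom K)} {P : List (Rule K)} {a : Atom K} :
    a ∈ consequence B P M I ↔ ∃ r ∈ P, (∀ b ∈ r.neg, b ∉ M) ∧ (∀ b ∈ r.pos, b ∈ I) ∧
      (∀ l ∈ r.aggs, l.CondSat B I M) ∧ r.head = a := by
  simp only [consequence, reduct, List.mem_toFinset, List.mem_map, List.mem_filter,
    decide_eq_true_eq]
  constructor
  · rintro ⟨_, ⟨⟨r, ⟨hr, hneg⟩, rfl⟩, hpos, haggs⟩, rfl⟩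
    exact ⟨r, hr, hneg, hpos, haggs, rfl⟩
  · rintro ⟨r, hr, hneg, hpos, haggs, rfl⟩
    exact ⟨_, ⟨⟨r, ⟨hr, hneg⟩, rfl⟩, hpos, haggs⟩, rfl⟩

theorem monotone_consequence (B : Finset (Atom K)) (P : List (Rule K)) (M : Finset (Atom K)) :
    Monotone (consequence B P M) := by
  intro I I' h a ha
  obtain ⟨r, hr, hneg, hpos, haggs, hhead⟩ := mem_consequence.1 ha
  exact mem_consequence.2
    ⟨r, hr, hneg, fun b hb => h (hpos b hb), fun l hl => (haggs l hl).mono h, hhead⟩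

theorem consequence_subset {B M I : Finset (Atom K)} {P : List (Rule K)}
    (hP : ∀ r ∈ P, r.head ∈ B) : consequence B P M I ⊆ B := by
  intro a ha
  obtain ⟨r, hr, -, -, -, rfl⟩ := mem_consequence.1 ha
  exact hP r hr

/-- Whether `(I, M) ⊨ l`, for lists `I` and `M` of atoms. -/
def AggAtom.condCheck (l : AggAtom K) (B I M : List (Atom K)) : Bool :=
  l.solutionCheck (l.extList B)
    ((l.extList B).filter fun a => decide (a ∈ I) && decide (a ∈ M))
    ((l.extList B).filter fun a => !decide (a ∈ M))

/-- Whether a rule is in the reduct with respect to `M` and its body holds in `I`. -/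
def Rule.fires (r : Rule K) (B M I : List (Atom K)) : Bool :=
  (r.neg.all fun b => !decide (b ∈ M)) && (r.pos.all fun a => decide (a ∈ I)) &&
    r.aggs.all fun l => l.condCheck B I M

/-- A listing of `K_M^P(I)`. -/
def consequenceList (B : List (Atom K)) (P : List (Rule K)) (M I : List (Atom K)) :
    List (Atom K) :=
  B.filter fun a => P.any fun r => decide (r.head = a) && r.fires B M I

/-- A listing of the least fixpoint of `K_M^P`: its iterates are constant after `|B|` steps. -/
def leastModel (B : List (Atom K)) (P : List (Rule K)) (M : List (Atom K)) : List (Atom K) :=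
  B.foldl (fun I _ => consequenceList B P M I) []

/-- Whether `M` lists an answer set. -/
def answerSetCheck (B : List (Atom K)) (P : List (Rule K)) (M : List (Atom K)) : Bool :=
  ((leastModel B P M).all fun a => decide (a ∈ M)) && M.all fun a => decide (a ∈ leastModel B P M)

variable [IsStrictOrderedRing K] {B : List (Atom K)} {P : List (Rule K)}

theorem AggAtom.condCheck_iff {l : AggAtom K} (hl : l.Tractable) (hB : B.Nodup)
    {I M : List (Atom K)} :
    l.condCheck B I M ↔ l.CondSat B.toFinset I.toFinset M.toFinset := by
  have hH : (l.extList B).Nodup := hB.filter _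
  let x : SolutionInstance K :=
    { l, B := B.toFinset, H := l.extList B,
      I := (l.extList B).filter fun a => decide (a ∈ I) && decide (a ∈ M),
      J := (l.extList B).filter fun a => !decide (a ∈ M),
      H_nodup := hH, I_nodup := hH.filter _, J_nodup := hH.filter _,
      H_eq := l.toFinset_extList B, I_sub := List.filter_sublist.subset,
      J_sub := List.filter_sublist.subset,
      disj := fun a => by simp only [List.mem_filter]; grind }
  have hI : x.I.toFinset = I.toFinset ∩ M.toFinset ∩ l.ext B.toFinset := by
    rw [← l.toFinset_extList]
    ext a
    simp only [x, List.mem_toFinset, List.mem_filter, Finset.mem_inter, Bool.and_eq_true,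
      decide_eq_true_eq]
    tauto
  have hJ : x.J.toFinset = l.ext B.toFinset \ M.toFinset := by
    rw [← l.toFinset_extList]
    ext a
    simp [x]
  rw [CondSat, ← hI, ← hJ]
  exact (x.yes_iff hl).symm

theorem Rule.fires_iff {r : Rule K} (hr : ∀ l ∈ r.aggs, l.Tractable) (hB : B.Nodup)
    {M I : List (Atom K)} :
    r.fires B M I ↔ (∀ b ∈ r.neg, b ∉ M.toFinset) ∧ (∀ b ∈ r.pos, b ∈ I.toFinset) ∧
      ∀ l ∈ r.aggs, l.CondSat B.toFinset I.toFinset M.toFinset := by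
  simp only [fires, Bool.and_eq_true, List.all_eq_true, Bool.not_eq_true', decide_eq_false_iff_not,
    decide_eq_true_eq, List.mem_toFinset, and_assoc]
  exact and_congr_right fun _ => and_congr_right fun _ =>
    forall₂_congr fun l hl => AggAtom.condCheck_iff (hr l hl) hB

theorem toFinset_consequenceList (hB : B.Nodup) (hP : ∀ r ∈ P, r.head ∈ B)
    (ht : ∀ r ∈ P, ∀ l ∈ r.aggs, l.Tractable) (M I : List (Atom K)) :
    (consequenceList B P M I).toFinset = consequence B.toFinset P M.toFinset I.toFinset := by
  ext a
  simp only [mem_consequence, List.mem_toFinset, consequenceList, List.mem_filter,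
    List.any_eq_true, Bool.and_eq_true, decide_eq_true_eq]
  constructor
  · rintro ⟨-, r, hr, hhead, hfires⟩
    obtain ⟨hneg, hpos, haggs⟩ := (Rule.fires_iff (ht r hr) hB).1 hfires
    exact ⟨r, hr, by simpa using hneg, by simpa using hpos, haggs, hhead⟩
  · rintro ⟨r, hr, hneg, hpos, haggs, rfl⟩
    exact ⟨hP r hr, r, hr, rfl,
      (Rule.fires_iff (ht r hr) hB).2 ⟨by simpa using hneg, by simpa using hpos, haggs⟩⟩

theorem toFinset_leastModel (hB : B.Nodup) (hP : ∀ r ∈ P, r.head ∈ B)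
    (ht : ∀ r ∈ P, ∀ l ∈ r.aggs, l.Tractable) (M : List (Atom K)) :
    (leastModel B P M).toFinset = (consequence B.toFinset P M.toFinset)^[B.length] ∅ := by
  have hfold (L I : List (Atom K)) :
      (L.foldl (fun I _ => consequenceList B P M I) I).toFinset =
        (consequence B.toFinset P M.toFinset)^[L.length] I.toFinset := by
    induction L generalizing I with
    | nil => rfl
    | cons a L ih =>
      rw [List.foldl_cons, ih, toFinset_consequenceList hB hP ht, List.length_cons,
        Function.iterate_succ_apply]
  exact hfold B []

theorem answerSetCheck_iff (hB : B.Nodup) (hP : ∀ r ∈ P, r.head ∈ B)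
    (ht : ∀ r ∈ P, ∀ l ∈ r.aggs, l.Tractable) (M : List (Atom K)) :
    answerSetCheck B P M ↔ IsAnswerSet B.toFinset P M.toFinset := by
  have hcheck : answerSetCheck B P M ↔ (leastModel B P M).toFinset = M.toFinset := by
    simp [answerSetCheck, Finset.Subset.antisymm_iff, Finset.subset_iff]
  rw [hcheck, toFinset_leastModel hB hP ht, IsAnswerSet,
    isLeast_fixpoint_iff_iterate_empty_eq (monotone_consequence _ _ _)
      (fun _ => consequence_subset (by simpa using hP)) (List.toFinset_card_le B)]

end AnswerSets

section Certificates

variable {K : Type} {α : Type}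

/-- The elements of a list whose positions carry a true entry in `y`, in reverse order. This makes
every tree a certificate for some sublist. -/
def Data.select (y : Data K) (l : List α) : List α :=
  (l.foldl (fun z a => (z.1.tl, bif z.1.hd.truthy then a :: z.2 else z.2)) (y, [])).2

theorem Data.select_code_map (p : α → Bool) (l : List α) :
    (code (l.map p) : Data K).select l = (l.filter p).reverse := by
  have hfold (l acc : List α) :
      (l.foldl (fun z a => (z.1.tl, bif z.1.hd.truthy then a :: z.2 else z.2))
        ((code (l.map p) : Data K), acc)).2 = (l.filter p).reverse ++ acc := by
    induction l generalizing acc with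
    | nil => rfl
    | cons a l ih =>
      have hhead : (Data.cons (code (p a)) (code (l.map p)) : Data K).hd.truthy = p a :=
        Data.truthy_code_bool _
      rw [List.map_cons, code_cons, List.foldl_cons]
      refine (ih _).trans ?_
      rw [hhead]
      cases h : p a <;> simp [h]
  rw [Data.select, hfold, List.append_nil]

end Certificates

section PolyTimeCheck

variable {K : Type} [Field K] [LinearOrder K] [CostModel K] {α ε : Type} [TreeCode K α]
  [TreeCode K ε]

namespace PolyTime

@[fun_prop]
theorem list_length {f : ε → List α} (hf : PolyTime K f) : PolyTime K (fun x => (f x).length) :=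
  of_data (natCast_list_length hf) fun _ => rfl

@[fun_prop]
theorem data_select {f : ε → List α} {y : ε → Data K} (hy : PolyTime K y) (hf : PolyTime K f) :
    PolyTime K (fun x => (y x).select (f x)) := by
  have ⟨p, hp, _⟩ := hf
  refine snd (list_foldl_of_growth (start := fun x => (y x, []))
    (step := fun _ z a => (z.1.tl, bif z.1.hd.truthy then a :: z.2 else z.2)) hf (by fun_prop)
    (by fun_prop) (p + 1) fun x z a ha => ?_)
  have ha := (vol_le_of_mem (K := K) ha).trans (hp x)
  have htl := Data.vol_tl_le z.1
  simp only [code_pair, Data.vol, Polynomial.eval_add, Polynomial.eval_one]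
  change _ + (z.1.tl).vol + _ ≤ _ + (z.1).vol + _ + _
  cases z.1.hd.truthy
  · simp only [cond_false]; omega
  · simp only [cond_true, code_cons, Data.vol]; omega

variable [CharZero K]

@[fun_prop]
theorem intensional_values {s : ε → Intensional K} {f : ε → List (Atom K)} (hs : PolyTime K s)
    (hf : PolyTime K f) : PolyTime K (fun x => (s x).values (f x)) := by
  unfold Intensional.values
  fun_prop

@[fun_prop]
theorem undecided {f g h : ε → List (Atom K)} (hf : PolyTime K f) (hg : PolyTime K g)
    (hh : PolyTime K h) : PolyTime K (fun x => undecided (f x) (g x) (h x)) := by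
  unfold AggSol.undecided
  fun_prop

@[fun_prop]
theorem aggAtom_solutionCheck {l : ε → AggAtom K} {f g h : ε → List (Atom K)} (hl : PolyTime K l)
    (hf : PolyTime K f) (hg : PolyTime K g) (hh : PolyTime K h) :
    PolyTime K (fun x => (l x).solutionCheck (f x) (g x) (h x)) := by
  unfold AggAtom.solutionCheck
  fun_prop

@[fun_prop]
theorem aggAtom_extList {l : ε → AggAtom K} {f : ε → List (Atom K)} (hl : PolyTime K l)
    (hf : PolyTime K f) : PolyTime K (fun x => (l x).extList (f x)) := by
  unfold AggAtom.extList
  fun_prop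

@[fun_prop]
theorem aggAtom_condCheck {l : ε → AggAtom K} {f g h : ε → List (Atom K)} (hl : PolyTime K l)
    (hf : PolyTime K f) (hg : PolyTime K g) (hh : PolyTime K h) :
    PolyTime K (fun x => (l x).condCheck (f x) (g x) (h x)) := by
  unfold AggAtom.condCheck
  fun_prop

@[fun_prop]
theorem rule_fires {r : ε → Rule K} {f g h : ε → List (Atom K)} (hr : PolyTime K r)
    (hf : PolyTime K f) (hg : PolyTime K g) (hh : PolyTime K h) :
    PolyTime K (fun x => (r x).fires (f x) (g x) (h x)) := by
  unfold Rule.fires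
  fun_prop

@[fun_prop]
theorem consequenceList {P : ε → List (Rule K)} {f g h : ε → List (Atom K)} (hP : PolyTime K P)
    (hf : PolyTime K f) (hg : PolyTime K g) (hh : PolyTime K h) :
    PolyTime K (fun x => consequenceList (f x) (P x) (g x) (h x)) := by
  unfold AggSol.consequenceList
  fun_prop

@[fun_prop]
theorem leastModel {P : ε → List (Rule K)} {f g : ε → List (Atom K)} (hP : PolyTime K P)
    (hf : PolyTime K f) (hg : PolyTime K g) :
    PolyTime K (fun x => leastModel (f x) (P x) (g x)) := by
  have ⟨p, hp, _⟩ := hf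
  refine list_foldl_of_bound (start := fun _ => [])
    (step := fun x I _ => AggSol.consequenceList (f x) (P x) (g x) I) hf (by fun_prop)
    (by fun_prop) p fun x l _ => (vol_le_of_sublist ?_).trans (hp x)
  obtain rfl | ⟨l, a, rfl⟩ := l.eq_nil_or_concat
  · exact List.nil_sublist _
  · rw [List.concat_eq_append, List.foldl_concat]
    exact List.filter_sublist

@[fun_prop]
theorem answerSetCheck {P : ε → List (Rule K)} {f g : ε → List (Atom K)} (hP : PolyTime K P)
    (hf : PolyTime K f) (hg : PolyTime K g) :
    PolyTime K (fun x => answerSetCheck (f x) (P x) (g x)) := by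
  unfold AggSol.answerSetCheck
  fun_prop

end PolyTime

end PolyTimeCheck

/-! ### Decision problems -/

theorem update_inputStore {K : Type} (d d' : Data K) :
    Function.update (inputStore d) 0 d' = inputStore d' := by
  funext i
  by_cases hi : i = 0 <;> simp [inputStore, hi]

namespace PolyTimeDecidable

variable {K α : Type} [Ring K] [LinearOrder K] {w : K → ℕ} {enc : α → Data K} {size : α → ℕ}
  {L : α → Prop}

theorem of_expr (e : Expr) {k : ℕ} (hcost : ∀ x, e.cost w (inputStore (enc x)) ≤ k)
    (h : PolyTimeDecidable w (fun x => e.eval (inputStore (enc x))) size L) :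
    PolyTimeDecidable w enc size L := by
  obtain ⟨c, p, hc⟩ := h
  refine ⟨.seq (.assign 0 e) c, p + Polynomial.C (1 + k), fun x => ?_⟩
  refine (HaltsWithin.assign_seq rfl (by rw [update_inputStore]; exact hc x)).of_le ?_
  have := hcost x
  simp only [Polynomial.eval_add, Polynomial.eval_C]
  omega

theorem ite (e : Expr) {k : ℕ} (hcost : ∀ x, e.cost w (inputStore (enc x)) ≤ k)
    (htrue : PolyTimeDecidable w
      (fun x : {x // e.eval (inputStore (enc x)) ≠ .nil} => enc x) (fun x => size x) (fun x => L x))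
    (hfalse : PolyTimeDecidable w
      (fun x : {x // e.eval (inputStore (enc x)) = .nil} => enc x) (fun x => size x)
      (fun x => L x)) :
    PolyTimeDecidable w enc size L := by
  obtain ⟨c, p, hc⟩ := htrue
  obtain ⟨d, q, hd⟩ := hfalse
  refine ⟨.ite e c d, p + q + Polynomial.C (1 + k), fun x => ?_⟩
  have := hcost x
  by_cases hx : e.eval (inputStore (enc x)) = .nil
  · refine (HaltsWithin.ite_of_eq_nil hx (hd ⟨x, hx⟩)).of_le ?_
    simp only [Polynomial.eval_add, Polynomial.eval_C]
    omega
  · refine (HaltsWithin.ite_of_ne_nil hx (hc ⟨x, hx⟩)).of_le ?_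
    simp only [Polynomial.eval_add, Polynomial.eval_C]
    omega

end PolyTimeDecidable

section PolyTimeDecidable

variable {K α β : Type} [Ring K] [LinearOrder K] [CostModel K] [TreeCode K β] {f : β → Bool}

theorem PolyTime.answers (hf : PolyTime K f) :
    ∃ (c : Cmd) (p : Polynomial ℕ), ∀ y : β,
      Answers CostModel.weight c (TreeCode.code y : Data K)
        (p.eval (TreeCode.code y : Data K).vol) (f y) := by
  obtain ⟨p, -, hc⟩ := hf
  obtain ⟨c, hc⟩ := hc 0
  refine ⟨.seq c (.assign 1 (.var 0)), p + 2, fun y => ?_⟩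
  refine HaltsWithin.of_le ((hc (inputStore (TreeCode.code y)) y rfl).seq fun s hs =>
    (HaltsWithin.assign rfl ?_).of_le (b' := 2) le_rfl) (by simp)
  rw [Function.update_self, Expr.eval, hs.1, code_bool_ne_nil]

theorem PolyTime.polyTimeDecidable (hf : PolyTime K f) {g : α → β} {size : α → ℕ} {L : α → Prop}
    (q : Polynomial ℕ) (hsize : ∀ x, (TreeCode.code (g x) : Data K).vol ≤ q.eval (size x))
    (hL : ∀ x, L x ↔ f (g x)) :
    PolyTimeDecidable CostModel.weight (fun x => (TreeCode.code (g x) : Data K)) size L := by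
  obtain ⟨c, p, hc⟩ := hf.answers
  refine ⟨c, p.comp q, fun x => HaltsWithin.mono (hc (g x)) ?_ fun s hs => hs.trans (hL x).symm⟩
  rw [Polynomial.eval_comp]
  exact monotone_polynomial_eval p (hsize x)

end PolyTimeDecidable

section UnitCost

variable {K : Type} [Field K]

/-- Arithmetic at unit cost, where numbers have no magnitude. -/
abbrev unitCostModel (K : Type) [Ring K] : CostModel K where
  weight := unitCost
  mag _ := 0
  weight_le _ := le_rfl
  mag_add _ _ := le_rfl
  mag_sub _ _ := le_rfl

attribute [local instance] unitCostModel

theorem vol_encNat (n : ℕ) : (encNat n : Data K).vol = 1 := rfl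

theorem Const.vol_enc_le (c : Const K) : c.enc.vol ≤ 3 := by
  cases c with
  | num x => exact Nat.le_add_left 1 2
  | sym n => exact le_rfl

theorem Term.vol_enc_le (t : Term K) : t.enc.vol ≤ 5 := by
  cases t with
  | const c =>
    have := c.vol_enc_le
    simp only [enc, Data.vol, vol_encNat]
    omega
  | var i => exact Nat.le_add_left 3 2

theorem Atom.vol_enc_le (a : Atom K) : a.enc.vol ≤ 3 + 4 * a.args.length := by
  have : (encList Const.enc a.args).vol ≤ _ := vol_le_of_forall_le fun c _ => c.vol_enc_le
  simp only [enc, Data.vol, vol_encNat]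
  omega

theorem AggFn.vol_enc (fn : AggFn) : (fn.enc : Data K).vol = 1 := by cases fn <;> rfl

theorem RelOp.vol_enc (op : RelOp) : (op.enc : Data K).vol = 1 := by cases op <;> rfl

theorem Kind.vol_enc (kind : Kind) : (kind.enc : Data K).vol = 1 := by cases kind <;> rfl

theorem AggAtom.vol_enc_le (l : AggAtom K) : l.enc.vol ≤ 13 + 6 * l.s.args.length := by
  have : (encList Term.enc l.s.args).vol ≤ _ := vol_le_of_forall_le fun t _ => t.vol_enc_le
  have : (Data.num l.v).vol = 1 := rfl
  simp only [enc, Intensional.enc, Data.vol, AggFn.vol_enc, RelOp.vol_enc, Kind.vol_enc, vol_encNat]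
    at *
  omega

variable [LinearOrder K]

namespace SolutionInstance

theorem vol_enc_le (x : SolutionInstance K) (hH : x.H ≠ []) : x.enc.vol ≤ 19 + 18 * x.extSize := by
  set k := x.l.s.args.length with hk
  have hsize : x.extSize = (k + 1) * x.H.length := by
    rw [extSize, ← x.H_eq, List.toFinset_card_of_nodup x.H_nodup]
  have hlist {L : List (Atom K)} (hnodup : L.Nodup) (hL : L ⊆ x.H) :
      (encList Atom.enc L).vol ≤ 1 + 4 * x.extSize := by
    have hatom (a : Atom K) (ha : a ∈ L) : a.enc.vol ≤ 3 + 4 * k := by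
      rw [hk, ← (Finset.mem_filter.1 (x.mem_H_iff.1 (hL ha))).2.2]
      exact a.vol_enc_le
    calc (encList Atom.enc L).vol ≤ 1 + L.length * (1 + (3 + 4 * k)) := vol_le_of_forall_le hatom
      _ ≤ 1 + x.H.length * (1 + (3 + 4 * k)) := by
        have := (hnodup.subperm hL).length_le
        gcongr
      _ = 1 + 4 * x.extSize := by rw [hsize]; ring
  have hl := x.l.vol_enc_le
  have hkH : k + 1 ≤ x.extSize := hsize ▸ Nat.le_mul_of_pos_right _ (List.length_pos_iff.2 hH)
  have := hlist x.H_nodup (List.Subset.refl _)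
  have := hlist x.I_nodup x.I_sub
  have := hlist x.J_nodup x.J_sub
  simp only [enc, Data.vol]
  omega

variable [IsStrictOrderedRing K]

theorem yes_iff_of_H_eq_nil {x : SolutionInstance K} (hx : x.l.Tractable) (hH : x.H = []) :
    x.Yes ↔ x.l.fn.groupCheck x.l.op x.l.v [] [] := by
  have hI : x.I = [] := List.subset_nil.1 (hH ▸ x.I_sub)
  rw [x.yes_iff hx, AggAtom.solutionCheck, hH, hI]
  rfl

theorem polyTimeDecidable_of_H_ne_nil :
    PolyTimeDecidable (K := K) unitCost
      (fun x : {x : SolutionInstance K // x.l.Tractable ∧ x.H ≠ []} => x.1.enc)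
      (fun x => x.1.extSize) (fun x => x.1.Yes) :=
  PolyTime.polyTimeDecidable
    (f := fun y : AggAtom K × List (Atom K) × List (Atom K) × List (Atom K) =>
      y.1.solutionCheck y.2.1 y.2.2.1 y.2.2.2) (by fun_prop)
    (g := fun x : {x : SolutionInstance K // x.l.Tractable ∧ x.H ≠ []} =>
      (x.1.l, x.1.H, x.1.I, x.1.J)) (19 + 18 * Polynomial.X)
    (fun x => (x.1.vol_enc_le x.2.2).trans_eq (by simp)) fun x => x.1.yes_iff x.2.1

theorem polyTimeDecidable_of_H_eq_nil :
    PolyTimeDecidable (K := K) unitCost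
      (fun x : {x : SolutionInstance K // x.l.Tractable ∧ x.H = []} => x.1.enc)
      (fun x => x.1.extSize) (fun x => x.1.Yes) := by
  let header : Expr := .cons (.path (.var 0) [false, false])
    (.cons (.path (.var 0) [false, true, false]) (.path (.var 0) [false, true, true, false]))
  refine .of_expr header (k := 14) (fun x => ?_) ?_
  · simp [header, Expr.cost, Expr.cost_path]
  · refine PolyTime.polyTimeDecidable
      (f := fun y : AggFn × RelOp × K => y.1.groupCheck y.2.1 y.2.2 [] []) (by fun_prop)
      (g := fun x : {x : SolutionInstance K // x.l.Tractable ∧ x.H = []} =>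
        (x.1.l.fn, x.1.l.op, x.1.l.v)) 5 (fun x => ?_) fun x => yes_iff_of_H_eq_nil x.2.1 x.2.2
    have hfn : (code x.1.l.fn : Data K).vol = 1 := x.1.l.fn.vol_enc
    have hop : (code x.1.l.op : Data K).vol = 1 := x.1.l.op.vol_enc
    simp [code_pair, code_num, Data.vol, hfn, hop, CostModel.mag]

/-- If `H(l)` is empty, then its size is `0` while the arity of the grouped predicate is unbounded,
so that the program must not read the arguments of the grouped atom. -/
theorem polyTimeDecidable :
    PolyTimeDecidable (K := K) unitCost
      (fun x : {x : SolutionInstance K // x.l.Tractable} => x.1.enc)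
      (fun x => x.1.extSize) (fun x => x.1.Yes) := by
  have htest (x : SolutionInstance K) :
      (Expr.path (.var 0) [true, false]).eval (inputStore x.enc) = .nil ↔ x.H = [] :=
    code_list_eq_nil
  obtain ⟨c, p, hc⟩ := polyTimeDecidable_of_H_ne_nil (K := K)
  obtain ⟨d, q, hd⟩ := polyTimeDecidable_of_H_eq_nil (K := K)
  exact .ite (.path (.var 0) [true, false]) (k := 3) (fun x => by simp [Expr.cost, Expr.cost_path])
    ⟨c, p, fun x => hc ⟨x.1.1, x.1.2, fun hH => x.2 ((htest x.1.1).2 hH)⟩⟩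
    ⟨d, q, fun x => hd ⟨x.1.1, x.1.2, (htest x.1.1).1 x.2⟩⟩

end SolutionInstance

end UnitCost

section Rational

/-- A magnitude of rational numbers. The numerator and the denominator of a sum are at most as long
as products of entries of both summands, up to a carry, so that the maximum plus one is subadditive;
the total length `bits` is not. -/
def ratMag (x : ℚ) : ℕ := max (Nat.size x.num.natAbs) (Nat.size x.den) + 1

theorem natAbs_num_add_le (x y : ℚ) :
    (x + y).num.natAbs ≤ x.num.natAbs * y.den + y.num.natAbs * x.den := by
  have hnum := congrArg Int.natAbs (Rat.add_num_den' x y)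
  simp only [Int.natAbs_mul, Int.natAbs_natCast] at hnum
  have hden : (x + y).den ≤ x.den * y.den :=
    Nat.le_of_dvd (Nat.mul_pos x.den_pos y.den_pos) (Rat.add_den_dvd x y)
  refine Nat.le_of_mul_le_mul_right ?_ (Nat.mul_pos x.den_pos y.den_pos)
  rw [← mul_assoc, hnum]
  refine Nat.mul_le_mul ((Int.natAbs_add_le _ _).trans_eq ?_) hden
  simp only [Int.natAbs_mul, Int.natAbs_natCast]

theorem ratMag_add (x y : ℚ) : ratMag (x + y) ≤ ratMag x + ratMag y := by
  set a := max (Nat.size x.num.natAbs) (Nat.size x.den) with ha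
  set b := max (Nat.size y.num.natAbs) (Nat.size y.den) with hb
  have hxnum : x.num.natAbs < 2 ^ a := Nat.size_le.1 (le_max_left _ _)
  have hxden : x.den < 2 ^ a := Nat.size_le.1 (le_max_right _ _)
  have hynum : y.num.natAbs < 2 ^ b := Nat.size_le.1 (le_max_left _ _)
  have hyden : y.den < 2 ^ b := Nat.size_le.1 (le_max_right _ _)
  have hmul {m n : ℕ} (hm : m < 2 ^ a) (hn : n < 2 ^ b) : m * n < 2 ^ (a + b) := by
    rw [pow_add]
    exact Nat.mul_lt_mul'' hm hn
  have hnum : Nat.size (x + y).num.natAbs ≤ a + b + 1 := by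
    rw [Nat.size_le, pow_succ]
    have := natAbs_num_add_le x y
    have := hmul hxnum hyden
    have := hmul hxden hynum
    rw [mul_comm] at this
    omega
  have hden : Nat.size (x + y).den ≤ a + b := by
    rw [Nat.size_le]
    exact (Nat.le_of_dvd (Nat.mul_pos x.den_pos y.den_pos) (Rat.add_den_dvd x y)).trans_lt
      (hmul hxden hyden)
  simp only [ratMag, ← ha, ← hb]
  omega

theorem ratMag_neg (x : ℚ) : ratMag (-x) = ratMag x := by
  simp [ratMag]

instance : CostModel ℚ where
  weight := bits
  mag := ratMag
  weight_le x := by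
    simp only [bits, ratMag]
    omega
  mag_add := ratMag_add
  mag_sub x y := by
    rw [sub_eq_add_neg, ← ratMag_neg y]
    exact ratMag_add x (-y)

theorem Data.vol_le_size (d : Data ℚ) : d.vol ≤ 2 * d.size := by
  induction d with
  | nil => exact Nat.le_succ 1
  | num x =>
    have : CostModel.mag x ≤ bits x + 1 := by
      change max _ _ + 1 ≤ _
      rw [bits]
      omega
    simp only [vol, size]
    omega
  | cons a b ha hb =>
    simp only [vol, size]
    omega

theorem PolyTime.inP {α β : Type} [TreeCode ℚ β] {f : β → Bool} (hf : PolyTime ℚ f) {g : α → β}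
    {L : α → Prop} (hL : ∀ x, L x ↔ f (g x)) :
    InP (fun x => (TreeCode.code (g x) : Data ℚ)) L :=
  hf.polyTimeDecidable (2 * Polynomial.X) (fun x => by simpa using Data.vol_le_size _) hL

theorem SolutionInstance.inP :
    InP (fun x : {x : SolutionInstance ℚ // x.l.Tractable} => x.1.enc) (fun x => x.1.Yes) :=
  PolyTime.inP
    (f := fun y : AggAtom ℚ × List (Atom ℚ) × List (Atom ℚ) × List (Atom ℚ) =>
      y.1.solutionCheck y.2.1 y.2.2.1 y.2.2.2) (by fun_prop)
    (g := fun x : {x : SolutionInstance ℚ // x.l.Tractable} => (x.1.l, x.1.H, x.1.I, x.1.J))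
    fun x => x.1.yes_iff x.2

theorem CheckInstance.inP :
    InP (fun x : {x : CheckInstance ℚ // x.P.Tractable} => x.1.enc) (fun x => x.1.Yes) :=
  PolyTime.inP
    (f := fun y : (List (Atom ℚ) × List (Rule ℚ)) × List (Atom ℚ) =>
      answerSetCheck y.1.1 y.1.2 y.2) (by fun_prop)
    (g := fun x : {x : CheckInstance ℚ // x.P.Tractable} => ((x.1.P.base, x.1.P.rules), x.1.M))
    fun x => (answerSetCheck_iff x.1.P.base_nodup x.1.P.head_mem x.2 x.1.M).symm

theorem size_code_map_le {α : Type} [TreeCode ℚ α] (p : α → Bool) (l : List α) :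
    (code (l.map p) : Data ℚ).size ≤ 4 * (code l : Data ℚ).size := by
  induction l with
  | nil => exact Nat.le_mul_of_pos_left _ four_pos
  | cons a l ih =>
    have : (code (p a) : Data ℚ).size ≤ 3 := by
      cases p a <;> simp [code_true, code_false, Data.size]
    simp only [List.map_cons, code_cons, Data.size]
    omega

theorem PolyTime.inNP {α β : Type} [TreeCode ℚ β] {f : β → Data ℚ → Bool}
    (hf : PolyTime ℚ fun y : β × Data ℚ => f y.1 y.2) {g : α → β} {L : α → Prop} (k : ℕ)
    (hL : ∀ x, L x ↔ ∃ y : Data ℚ, y.size ≤ k * (TreeCode.code (g x) : Data ℚ).size ∧ f (g x) y) :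
    InNP (fun x => (TreeCode.code (g x) : Data ℚ)) L := by
  obtain ⟨c, p, hc⟩ := hf.answers
  refine ⟨c, p.comp (2 + Polynomial.C (2 + 2 * k) * Polynomial.X),
    Polynomial.C k * Polynomial.X, fun x y => f (g x) y, fun x y hy => ?_, by simpa using hL⟩
  refine HaltsWithin.of_le (hc (g x, y)) ?_
  have hvol := Data.vol_le_size (.cons (TreeCode.code (g x)) y)
  simp only [Polynomial.eval_mul, Polynomial.eval_C, Polynomial.eval_X] at hy
  rw [Polynomial.eval_comp]
  refine monotone_polynomial_eval p (hvol.trans ?_)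
  simp only [Data.size, Polynomial.eval_add, Polynomial.eval_mul, Polynomial.eval_C,
    Polynomial.eval_X, Polynomial.eval_ofNat]
  linarith

theorem Program.hasAnswerSet_iff (P : Program ℚ) (hP : P.Tractable) :
    P.HasAnswerSet ↔ ∃ y : Data ℚ, y.size ≤ 4 * P.enc.size ∧
      answerSetCheck P.base P.rules (y.select P.base) := by
  simp only [answerSetCheck_iff P.base_nodup P.head_mem hP]
  constructor
  · rintro ⟨M, hM⟩
    refine ⟨code (P.base.map fun a => decide (a ∈ M)), ?_, ?_⟩
    · refine (size_code_map_le _ P.base).trans (Nat.mul_le_mul_left 4 ?_)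
      change _ ≤ 1 + (code P.base : Data ℚ).size + _
      omega
    · have hbase : ((P.base.filter fun a => decide (a ∈ M)).reverse).toFinset = M := by
        ext a
        simpa using fun ha => List.mem_toFinset.1 (hM.1.1 ha)
      rw [Data.select_code_map, hbase]
      exact hM
  · rintro ⟨y, -, hy⟩
    exact ⟨_, hy⟩

theorem Program.inNP_hasAnswerSet :
    InNP (fun P : {P : Program ℚ // P.Tractable} => P.1.enc) (fun P => P.1.HasAnswerSet) :=
  PolyTime.inNP
    (f := fun y : List (Atom ℚ) × List (Rule ℚ) => fun d =>
      answerSetCheck y.1 y.2 (d.select y.1)) (by fun_prop)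
    (g := fun P : {P : Program ℚ // P.Tractable} => (P.1.base, P.1.rules)) 4
    fun P => P.1.hasAnswerSet_iff P.2

end Rational

end AggSol

theorem mainTheorem10_general {K : Type} [Field K] [LinearOrder K] [IsStrictOrderedRing K] :
    AggSol.PolyTimeDecidable (K := K) AggSol.unitCost
      (fun x : {x : AggSol.SolutionInstance K // x.l.Tractable} => x.1.enc)
      (fun x => x.1.extSize) (fun x => x.1.Yes) ∧
    AggSol.InP (fun x : {x : AggSol.SolutionInstance ℚ // x.l.Tractable} => x.1.enc)
      (fun x => x.1.Yes) ∧
    AggSol.InP (fun x : {x : AggSol.CheckInstance ℚ // x.P.Tractable} => x.1.enc)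
      (fun x => x.1.Yes) ∧
    AggSol.InNP (fun P : {P : AggSol.Program ℚ // P.Tractable} => P.1.enc)
      (fun P => P.1.HasAnswerSet) :=
  ⟨AggSol.SolutionInstance.polyTimeDecidable, AggSol.SolutionInstance.inP,
    AggSol.CheckInstance.inP, AggSol.Program.inNP_hasAnswerSet⟩

theorem mainTheorem10 :
    -- Solution checking for real data, with unit-cost arithmetic, in time polynomial in `H(l)`.
    AggSol.PolyTimeDecidable (K := ℝ) AggSol.unitCost
      (fun x : {x : AggSol.SolutionInstance ℝ // x.l.Tractable} => x.1.enc)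
      (fun x => x.1.extSize) (fun x => x.1.Yes) ∧
    -- Solution checking for rational data is in P.
    AggSol.InP (fun x : {x : AggSol.SolutionInstance ℚ // x.l.Tractable} => x.1.enc)
      (fun x => x.1.Yes) ∧
    -- Answer set checking is in P.
    AggSol.InP (fun x : {x : AggSol.CheckInstance ℚ // x.P.Tractable} => x.1.enc)
      (fun x => x.1.Yes) ∧
    -- Answer set existence is in NP.
    AggSol.InNP (fun P : {P : AggSol.Program ℚ // P.Tractable} => P.1.enc)
      (fun P => P.1.HasAnswerSet) :=
  mainTheorem10_general
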